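/- **Call-by-value terms.** $\lambda$-terms $M::=V\mid MN$ and values $V::=x\mid\lambda x.M$ are taken up to $\alpha$-conversion. The reduction $\to_{\mathsf v}$ is the contextual closure (also under abstractions) of the rules, where $V$ is a value: $(\beta_v)$ $(\lambda x.M)V\to M[V/x]$; $(\sigma_1)$ $(\lambda x.M)NP\to(\lambda x.MP)N$ with $x\notin\mathrm{FV}(P)$; $(\sigma_3)$ $V((\lambda x.M)N)\to(\lambda x.VM)N$ with $x\notin\mathrm{FV}(V)$. Its reflexive transitive closure is written $\twoheadrightarrow_{\mathsf v}$. **Böhm trees.** On $\lambda$-terms possibly containing a constant $\bot$, let $\sqsubseteq$ be the context-closed preorder generated by $\bot\sqsubseteq x$ and $\bot\sqsubseteq\lambda x.M$. The set $\mathcal A$ of approximants is given by the grammar ($k\ge0$) $A::=B\mid C$, $\;B::=x\mid\lambda x.A\mid\bot\mid xBA_1\cdots A_k$, $\;C::=(\lambda x.A)(yBA_1\cdots A_k)$. For a $\lambda$-term $M$ let $\mathcal A(M)=\{A\in\mathcal A\mid \exists N\ \lambda\text{-term},\ M\twoheadrightarrow_{\mathsf v}N\text{ and }A\sqsubseteq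 N\}$. The Böhm tree $\mathrm{BT}(M)$ is the supremum $\bigsqcup\mathcal A(M)$ in the set of possibly infinite labelled syntax trees (including the empty tree) ordered by the extension of $\sqsubseteq$, where $\bigsqcup\emptyset$ is the empty tree. **Resource calculus.** Resource values $v::=x\mid\lambda x.t$ and simple terms $s,t::=st\mid[v_1,\dots,v_k]$ ($k\ge0$), where $[v_1,\dots,v_k]$ is a finite multiset; resource terms $e$ are resource values or simple terms, up to $\alpha$-conversion. If $x$ has exactly $n$ free occurrences in $t$, the linear substitution $t\langle x:=v_1,\dots,v_n\rangle$ is the set of all terms obtained by replacing the $i$-th free occurrence of $x$ in $t$ by $v_{\pi(i)}$ for every $i$ (without capture), for $\pi$ a permutation of $\{1,\dots,n\}$; if the number of occurrences is not $n$, it is $\emptyset$. The reduction $\to_{\mathsf r}$ from resource terms to finite sets of resource terms is generated by $[\lambda x.t][v_1,\dots,v_n]\to t\langle x:=v_1,\dots,v_n\rangle$; $[v_1,\dots,v_n]\,t\to\emptyset$ if $n\ne1$; $[\lambda x.t]s_1s_2\to\{[\lambda x.ts_2]s_1\}$ with $x\notin\mathrm{FV}(s_2)$; $[v]([\lambda x.t]s)\to\{[\lambda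 x.[v]t]s\}$ with $x\notin\mathrm{FV}(v)$; and closed under contexts, all constructors being extended elementwise to sets. It is extended to finite sets of resource terms by $\{e\}\cup E_2\to_{\mathsf r}E_1\cup E_2$ whenever $e\to_{\mathsf r}E_1$ and $e\notin E_2$. The normal form $\mathrm{nf}_{\mathsf r}(e)$ of $e$ is the set that cannot be reduced and is reached from $\{e\}$ by the reflexive transitive closure of $\to_{\mathsf r}$, and for an arbitrary set $E$ of resource terms $\mathrm{NF}(E)=\bigcup_{e\in E}\mathrm{nf}_{\mathsf r}(e)$. **Taylor expansion.** $\mathcal T(x)=\{[x,\dots,x]\ (n\text{ times})\mid n\ge0\}$, $\mathcal T(\lambda x.N)=\{[\lambda x.t_1,\dots,\lambda x.t_n]\mid n\ge0,\ t_1,\dots,t_n\in\mathcal T(N)\}$, $\mathcal T(PQ)=\{st\mid s\in\mathcal T(P),\ t\in\mathcal T(Q)\}$. **Corollary.** For all $\lambda$-terms $M,N$, the following are equivalent: 1. $\mathrm{BT}(M)=\mathrm{BT}(N)$; 2. $\mathrm{NF}(\mathcal T(M))=\mathrm{NF}(\mathcal T(N))$. -/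

import Mathlib

namespace CbV

/-! ## The call-by-value lambda-calculus with permutation rules

Terms are taken up to alpha-conversion, by means of de Bruijn indices: `var n` refers to the `n`-th
enclosing abstraction, and the indices pointing outside of the term are its free variables. -/

/-- The set of lambda-terms. -/
inductive Term : Type
  | var : ℕ → Term
  | lam : Term → Term
  | app : Term → Term → Term

namespace Term

/-- Increment all indices `≥ c`. -/
def shift : ℕ → Term → Term
  | c, var n => if n < c then var n else var (n + 1)
  | c, lam M => lam (shift (c + 1) M)
  | c, app M N => app (shift c M) (shift c N)

/-- `subst k N M` is `M` in which the variable `k` is replaced by `N` (capture-free), the binder of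
`k` being removed. -/
def subst : ℕ → Term → Term → Term
  | k, N, var n => if n = k then N else if k < n then var (n - 1) else var n
  | k, N, lam M => lam (subst (k + 1) (shift 0 N) M)
  | k, N, app M P => app (subst k N M) (subst k N P)

/-- Values: variables and abstractions. -/
inductive IsValue : Term → Prop
  | var (n : ℕ) : IsValue (var n)
  | lam (M : Term) : IsValue (lam M)

/-- One-step reduction `→_v`: the contextual closure of the rules `β_v`, `σ₁` and `σ₃`. -/
inductive Step : Term → Term → Prop
  | beta (M V : Term) : IsValue V → Step (app (lam M) V) (subst 0 V M)
  | sigma1 (M N P : Term) : Step (app (app (lam M) N) P) (app (lam (app M (shift 0 P))) N)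
  | sigma3 (V M N : Term) : IsValue V →
      Step (app V (app (lam M) N)) (app (lam (app (shift 0 V) M)) N)
  | lam {M M' : Term} : Step M M' → Step (lam M) (lam M')
  | appL {M M' : Term} (N : Term) : Step M M' → Step (app M N) (app M' N)
  | appR (M : Term) {N N' : Term} : Step N N' → Step (app M N) (app M N')

/-- Multistep reduction, the reflexive transitive closure of `→_v`. -/
def Steps : Term → Term → Prop := Relation.ReflTransGen Step

end Term

/-! ## Approximants -/

/-- Lambda-terms possibly containing the constant `⊥`. -/
inductive BotTerm : Type
  | bot : BotTerm
  | var : ℕ → BotTerm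
  | lam : BotTerm → BotTerm
  | app : BotTerm → BotTerm → BotTerm

/-- The inclusion of lambda-terms into the terms possibly containing `⊥`. -/
def Term.toBot : Term → BotTerm
  | .var n => .var n
  | .lam M => .lam M.toBot
  | .app M N => .app M.toBot N.toBot

namespace BotTerm

/-- The context-closed preorder `⊑` generated by `⊥ ⊑ x` and `⊥ ⊑ λx.M`. -/
inductive Below : BotTerm → BotTerm → Prop
  | bot_var (n : ℕ) : Below bot (var n)
  | bot_lam (M : BotTerm) : Below bot (lam M)
  | refl (M : BotTerm) : Below M M
  | trans {M N P : BotTerm} : Below M N → Below N P → Below M P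
  | lam {M M' : BotTerm} : Below M M' → Below (lam M) (lam M')
  | app {M M' N N' : BotTerm} : Below M M' → Below N N' → Below (app M N) (app M' N')

/-- The syntactic categories of the grammar of approximants
`A ::= B | C`, `B ::= x | λx.A | ⊥ | S`, `C ::= (λx.A) S`, where `S ::= x B A₁ ⋯ A_k` (`k ≥ 0`). -/
inductive Cat : Type
  | A | B | C | S

/-- `Derives c M`: the term `M` is generated from the category `c`. -/
inductive Derives : Cat → BotTerm → Prop
  | A_of_B {M : BotTerm} : Derives .B M → Derives .A M
  | A_of_C {M : BotTerm} : Derives .C M → Derives .A M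
  | B_var (n : ℕ) : Derives .B (var n)
  | B_lam {M : BotTerm} : Derives .A M → Derives .B (lam M)
  | B_bot : Derives .B bot
  | B_of_S {M : BotTerm} : Derives .S M → Derives .B M
  | C_app {M N : BotTerm} : Derives .A M → Derives .S N → Derives .C (app (lam M) N)
  | S_head (n : ℕ) {M : BotTerm} : Derives .B M → Derives .S (app (var n) M)
  | S_app {M N : BotTerm} : Derives .S M → Derives .A N → Derives .S (app M N)

/-- The set of approximants. -/
def approximants : Set BotTerm := {A | Derives .A A}

end BotTerm

/-- The set of approximants of a lambda-term. -/
def approxOf (M : Term) : Set BotTerm :=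
  {A | A ∈ BotTerm.approximants ∧ ∃ N : Term, Term.Steps M N ∧ BotTerm.Below A N.toBot}

/-! ## Possibly infinite labelled trees and Böhm trees -/

/-- Node labels. -/
inductive Label : Type
  | bot : Label
  | var : ℕ → Label
  | lam : Label
  | app : Label

/-- The order on labels: `⊥` is below variables and abstractions, and not below applications. -/
inductive Label.Below : Label → Label → Prop
  | refl (a : Label) : Below a a
  | bot_var (n : ℕ) : Below .bot (.var n)
  | bot_lam : Below .bot .lam

/-- Possibly infinite (possibly empty) syntax trees of terms with `⊥`. A position is a list of
directions from the root; `false` leads to the body of an abstraction or to the function part of an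
application, `true` to the argument of an application. The label is `none` outside of the tree. -/
@[ext] structure Tree : Type where
  label : List Bool → Option Label
  wf : ∀ p d, (label (p ++ [d])).isSome ↔
    (label p = some .app ∨ (label p = some .lam ∧ d = false))

namespace Tree

/-- The order `⊑` extended to possibly infinite trees: a tree gets larger by replacing some leaves
`⊥` by trees whose root is a variable or an abstraction. The empty tree is the least one. -/
instance : PartialOrder Tree where
  le T U := ∀ p a, T.label p = some a → ∃ b, U.label p = some b ∧ a.Below b
  le_refl T p a h := ⟨a, h, .refl a⟩
  le_trans T U W h₁ h₂ p a h := by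
    obtain ⟨b, hb, hab⟩ := h₁ p a h
    obtain ⟨c, hc, hbc⟩ := h₂ p b hb
    refine ⟨c, hc, ?_⟩
    cases hab <;> cases hbc <;> constructor
  le_antisymm T U h₁ h₂ := by
    ext p : 2
    rcases hT : T.label p with _ | a
    · rcases hU : U.label p with _ | b
      · rfl
      · obtain ⟨c, hc, -⟩ := h₂ p b hU
        simp [hT] at hc
    · obtain ⟨b, hb, hab⟩ := h₁ p a hT
      obtain ⟨c, hc, hbc⟩ := h₂ p b hb
      rw [hT] at hc
      cases hc
      rw [hb]
      cases hab <;> cases hbc <;> rfl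

/-- The empty tree. -/
def empty : Tree where
  label _ := none
  wf p d := by simp

/-- Every directed set of trees has a supremum. -/
theorem exists_isLUB {S : Set Tree} (hS : DirectedOn (· ≤ ·) S) : ∃ T, IsLUB S T := by
  have key : ∀ p, ∃ o : Option Label, (∀ a, o = some a → ∃ T ∈ S, T.label p = some a) ∧
      ∀ U ∈ S, ∀ b, U.label p = some b → ∃ a, o = some a ∧ b.Below a := by
    intro p
    by_cases h₁ : ∃ T ∈ S, ∃ a, T.label p = some a ∧ a ≠ .bot
    · obtain ⟨T, hT, a, ha, hne⟩ := h₁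
      refine ⟨some a, fun _ h => ⟨T, hT, by rw [ha, h]⟩, fun U hU b hb => ⟨a, rfl, ?_⟩⟩
      obtain ⟨W, -, hTW, hUW⟩ := hS T hT U hU
      obtain ⟨c, hc, hac⟩ := hTW p a ha
      obtain ⟨c', hc', hbc⟩ := hUW p b hb
      have hcc : c' = c := by simpa [hc'] using hc
      have hca : c = a := by cases hac <;> simp_all
      rwa [hcc, hca] at hbc
    · have h₂ : ∀ T ∈ S, ∀ a, T.label p = some a → a = .bot := by
        intro T hT a ha
        by_contra hne
        exact h₁ ⟨T, hT, a, ha, hne⟩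
      by_cases h₃ : ∃ T ∈ S, T.label p = some .bot
      · obtain ⟨T, hT, ha⟩ := h₃
        refine ⟨some .bot, fun _ h => ⟨T, hT, by rw [ha, h]⟩, fun U hU b hb => ⟨.bot, rfl, ?_⟩⟩
        rw [h₂ U hU b hb]
        exact .refl _
      · refine ⟨none, by simp, fun U hU b hb => absurd ⟨U, hU, ?_⟩ h₃⟩
        rw [hb, h₂ U hU b hb]
  choose l hl₁ hl₂ using key
  refine ⟨⟨l, fun p d => ⟨fun h => ?_, fun h => ?_⟩⟩, ?_, ?_⟩
  · obtain ⟨a, ha⟩ := Option.isSome_iff_exists.1 h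
    obtain ⟨T, hT, hTa⟩ := hl₁ _ a ha
    rcases (T.wf p d).1 (by simp [hTa]) with h' | ⟨h', hd⟩
    · obtain ⟨c, hc, hac⟩ := hl₂ p T hT _ h'
      cases hac
      exact .inl hc
    · obtain ⟨c, hc, hac⟩ := hl₂ p T hT _ h'
      cases hac
      exact .inr ⟨hc, hd⟩
  · have : ∃ T ∈ S, (T.label (p ++ [d])).isSome := by
      rcases h with h | ⟨h, hd⟩
      · obtain ⟨T, hT, hTa⟩ := hl₁ _ _ h
        exact ⟨T, hT, (T.wf p d).2 (.inl hTa)⟩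
      · obtain ⟨T, hT, hTa⟩ := hl₁ _ _ h
        exact ⟨T, hT, (T.wf p d).2 (.inr ⟨hTa, hd⟩)⟩
    obtain ⟨T, hT, hs⟩ := this
    obtain ⟨a, ha⟩ := Option.isSome_iff_exists.1 hs
    obtain ⟨c, hc, -⟩ := hl₂ _ T hT a ha
    simp [hc]
  · intro T hT p a ha
    exact hl₂ p T hT a ha
  · intro W hW p a ha
    obtain ⟨T, hT, hTa⟩ := hl₁ p a ha
    exact hW hT p a hTa

open Classical in
/-- The supremum of a set of trees. It exists for every directed set, see `exists_isLUB`; the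
supremum of the empty set is the empty tree (the least tree). -/
noncomputable def sup (S : Set Tree) : Tree :=
  if h : ∃ T, IsLUB S T then h.choose else empty

end Tree

/-- The labels of the syntax tree of a term with `⊥`. -/
def BotTerm.label : BotTerm → List Bool → Option Label
  | .bot, [] => some .bot
  | .var n, [] => some (.var n)
  | .lam _, [] => some .lam
  | .app _ _, [] => some .app
  | .lam M, false :: p => M.label p
  | .app M _, false :: p => M.label p
  | .app _ N, true :: p => N.label p
  | _, _ => none

/-- The syntax tree of a term with `⊥`. -/
def BotTerm.toTree (A : BotTerm) : Tree where
  label := A.label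
  wf := by
    induction A with
    | bot => intro p d; rcases p with _ | ⟨_, p⟩ <;> simp [BotTerm.label]
    | var n => intro p d; rcases p with _ | ⟨_, p⟩ <;> simp [BotTerm.label]
    | lam M ih =>
      intro p d
      rcases p with _ | ⟨_ | _, p⟩
      · cases d
        · cases M <;> simp [BotTerm.label]
        · simp [BotTerm.label]
      · simpa [BotTerm.label] using ih p d
      · simp [BotTerm.label]
    | app M N ihM ihN =>
      intro p d
      rcases p with _ | ⟨_ | _, p⟩
      · cases d
        · cases M <;> simp [BotTerm.label]
        · cases N <;> simp [BotTerm.label]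
      · simpa [BotTerm.label] using ihM p d
      · simpa [BotTerm.label] using ihN p d

/-- The Böhm tree of a lambda-term: the supremum of its approximants. -/
noncomputable def bohmTree (M : Term) : Tree :=
  Tree.sup (BotTerm.toTree '' approxOf M)

/-! ## The resource calculus -/

/-- The kinds of resource expressions: resource values, simple terms, and (lists representing)
bags. -/
inductive Kind : Type
  | val | tm | bag

/-- Resource expressions before the identification of the bags that differ in the order of their
elements: resource values `x`, `λx.t`, simple terms `s t`, `[v₁, …, v_k]`. -/
inductive Pre : Kind → Type
  | var : ℕ → Pre .val
  | lam : Pre .tm → Pre .val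
  | app : Pre .tm → Pre .tm → Pre .tm
  | bag : Pre .bag → Pre .tm
  | nil : Pre .bag
  | cons : Pre .val → Pre .bag → Pre .bag

namespace Pre

/-- The list of the elements of a bag. -/
def toList : Pre .bag → List (Pre .val)
  | nil => []
  | cons v b => v :: toList b

/-- Bags are multisets: the congruence that identifies bags up to the order of their elements, at
any depth. -/
inductive Equiv : {κ : Kind} → Pre κ → Pre κ → Prop
  | refl {κ : Kind} (e : Pre κ) : Equiv e e
  | symm {κ : Kind} {e e' : Pre κ} : Equiv e e' → Equiv e' e
  | trans {κ : Kind} {e e' e'' : Pre κ} : Equiv e e' → Equiv e' e'' → Equiv e e''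
  | swap (v w : Pre .val) (b : Pre .bag) : Equiv (cons v (cons w b)) (cons w (cons v b))
  | lam {t t' : Pre .tm} : Equiv t t' → Equiv (lam t) (lam t')
  | app {s s' t t' : Pre .tm} : Equiv s s' → Equiv t t' → Equiv (app s t) (app s' t')
  | bag {b b' : Pre .bag} : Equiv b b' → Equiv (bag b) (bag b')
  | cons {v v' : Pre .val} {b b' : Pre .bag} :
      Equiv v v' → Equiv b b' → Equiv (cons v b) (cons v' b')

instance setoid (κ : Kind) : Setoid (Pre κ) where
  r := Equiv
  iseqv := ⟨Equiv.refl, Equiv.symm, Equiv.trans⟩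

/-- Increment all indices `≥ c`. -/
def shift : {κ : Kind} → ℕ → Pre κ → Pre κ
  | _, c, var n => if n < c then var n else var (n + 1)
  | _, c, lam t => lam (shift (c + 1) t)
  | _, c, app s t => app (shift c s) (shift c t)
  | _, c, bag b => bag (shift c b)
  | _, _, nil => nil
  | _, c, cons v b => cons (shift c v) (shift c b)

/-- The degree: the number of free occurrences of the variable `k`. -/
def deg : {κ : Kind} → ℕ → Pre κ → ℕ
  | _, k, var n => if n = k then 1 else 0
  | _, k, lam t => deg (k + 1) t
  | _, k, app s t => deg k s + deg k t
  | _, k, bag b => deg k b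
  | _, _, nil => 0
  | _, k, cons v b => deg k v + deg k b

/-- `plug k e [v₁, …, v_n]`, for `n` the degree of `k` in `e`: the `i`-th free occurrence (from left
to right) of the variable `k` in `e` is replaced by `v_i` (capture-free), the binder of `k` being
removed. -/
def plug : {κ : Kind} → ℕ → Pre κ → List (Pre .val) → Pre κ
  | _, k, var n, vs => if n = k then vs.headD (var n) else if k < n then var (n - 1) else var n
  | _, k, lam t, vs => lam (plug (k + 1) t (vs.map (shift 0)))
  | _, k, app s t, vs => app (plug k s (vs.take (deg k s))) (plug k t (vs.drop (deg k s)))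
  | _, k, bag b, vs => bag (plug k b vs)
  | _, _, nil, _ => nil
  | _, k, cons v b, vs => cons (plug k v (vs.take (deg k v))) (plug k b (vs.drop (deg k v)))

/-- The linear substitution of `v₁, …, v_n` for the variable `0` in `e`: all results of replacing the
free occurrences of the variable by the `v_i` in some order, and the empty set if the number of
occurrences is not `n`. -/
def linSubst {κ : Kind} (e : Pre κ) (vs : List (Pre .val)) : Set (Pre κ) :=
  {e' | deg 0 e = vs.length ∧ ∃ ws : List (Pre .val), ws.Perm vs ∧ e' = plug 0 e ws}

/-- One-step reduction of a resource expression to a set of resource expressions: the closure of the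
rules `β_r`, `0`, `σ₁`, `σ₃` under (multilinear) contexts. -/
inductive Step : {κ : Kind} → Pre κ → Set (Pre κ) → Prop
  | beta (t : Pre .tm) (b : Pre .bag) :
      Step (app (bag (cons (lam t) nil)) (bag b)) (linSubst t b.toList)
  | zero (b : Pre .bag) (t : Pre .tm) : b.toList.length ≠ 1 → Step (app (bag b) t) ∅
  | sigma1 (t s₁ s₂ : Pre .tm) :
      Step (app (app (bag (cons (lam t) nil)) s₁) s₂)
        {app (bag (cons (lam (app t (shift 0 s₂))) nil)) s₁}
  | sigma3 (v : Pre .val) (t s : Pre .tm) :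
      Step (app (bag (cons v nil)) (app (bag (cons (lam t) nil)) s))
        {app (bag (cons (lam (app (bag (cons (shift 0 v) nil)) t)) nil)) s}
  | lam {t : Pre .tm} {T : Set (Pre .tm)} : Step t T → Step (lam t) (lam '' T)
  | appL {s : Pre .tm} {S : Set (Pre .tm)} (t : Pre .tm) :
      Step s S → Step (app s t) ((fun s' => app s' t) '' S)
  | appR (s : Pre .tm) {t : Pre .tm} {T : Set (Pre .tm)} :
      Step t T → Step (app s t) ((fun t' => app s t') '' T)
  | bag {b : Pre .bag} {B : Set (Pre .bag)} : Step b B → Step (bag b) (bag '' B)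
  | consHead {v : Pre .val} {V : Set (Pre .val)} (b : Pre .bag) :
      Step v V → Step (cons v b) ((fun v' => cons v' b) '' V)
  | consTail (v : Pre .val) {b : Pre .bag} {B : Set (Pre .bag)} :
      Step b B → Step (cons v b) ((fun b' => cons v b') '' B)

/-- Representatives of the elements of the Taylor expansion of a lambda-term. -/
def taylor : Term → Set (Pre .tm)
  | .var n => {s | ∃ b : Pre .bag, s = bag b ∧ ∀ v ∈ b.toList, v = var n}
  | .lam N => {s | ∃ b : Pre .bag, s = bag b ∧ ∀ v ∈ b.toList, ∃ t ∈ taylor N, v = lam t}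
  | .app P Q => {s | ∃ p ∈ taylor P, ∃ q ∈ taylor Q, s = app p q}

end Pre

/-- Resource expressions: `Res .val` is the set of resource values and `Res .tm` the set of simple
terms, in which bags are finite multisets. -/
def Res (κ : Kind) : Type := Quotient (Pre.setoid κ)

/-- The class of a resource expression up to the order of the elements in its bags. -/
def Res.mk {κ : Kind} (e : Pre κ) : Res κ := Quotient.mk (Pre.setoid κ) e

/-- The reduction `→_r` between finite sets of resource expressions:
`{e} ∪ E₂ →_r E₁ ∪ E₂` whenever `e →_r E₁` and `e ∉ E₂`. -/
def Res.SetStep {κ : Kind} (E F : Set (Res κ)) : Prop :=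
  ∃ (e : Pre κ) (E₁ : Set (Pre κ)) (E₂ : Set (Res κ)), Pre.Step e E₁ ∧ E₂.Finite ∧
    Res.mk e ∉ E₂ ∧ E = {Res.mk e} ∪ E₂ ∧ F = (Res.mk '' E₁) ∪ E₂

/-- `F` is an r-normal form of `E`: a set that cannot be reduced, reached from `E` by the reflexive
transitive closure of `→_r`. -/
def Res.IsNormalFormOf {κ : Kind} (F E : Set (Res κ)) : Prop :=
  Relation.ReflTransGen Res.SetStep E F ∧ ¬ ∃ F', Res.SetStep F F'

/-- The normal form of an arbitrary set of resource expressions: the union of the r-normal forms of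
its elements. -/
def Res.NF {κ : Kind} (E : Set (Res κ)) : Set (Res κ) :=
  {a | ∃ e ∈ E, ∃ F, Res.IsNormalFormOf F {e} ∧ a ∈ F}

/-- The Taylor expansion of a lambda-term, a set of simple terms. -/
def taylor (M : Term) : Set (Res .tm) := Res.mk '' Pre.taylor M

end CbV

namespace CbV

/-! ### Shifting and substitution with de Bruijn indices. -/

namespace Term

/-! Both the Böhm tree and the normalized Taylor expansion of `M` carry exactly the information of
the set `approxOf M`, so each is compared with that set.

On the resource side, `Res.mk_mem_NF_taylor_iff` identifies the normal form of the expansion of `M`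
with the irreducible elements of the expansions of the approximants of `M`. For one inclusion,
approximation up to reduction (`Pre.Approx`) is preserved by resource reduction, and an irreducible
expression that approximates `M` in this sense lies in the expansion of a single reduct of `M`
(`Pre.Approx.exists_inT`). Pruning from that reduct whatever the expression does not see yields an
approximant (`Pre.apx`, `Pre.derives_apx`). For the other, an irreducible element of the expansion
of a reduct is produced by some element of the expansion of `M` (`Pre.InT.exists_reds_of_steps`),
and it can be kept while the remaining finite set is normalized (`Res.exists_normal`). Only the
existence of normal forms matters here, not their uniqueness. An approximant `A` is recovered from
the single expression `Pre.full A`, which belongs to the expansion of `B` only if `A ⊑ B`.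

On the tree side, `approxOf M` is directed, so its supremum is a genuine one. Finite trees are
compact (`BotTerm.exists_le_of_le_sup`), hence an approximant lies below the Böhm tree exactly when
it belongs to `approxOf M`.

Gluing the different reducts seen by the elements of a bag, and directedness, both rest on
confluence (`Term.Steps.confluent`). The permutation rules terminate and are locally confluent,
parallel `β_v` has the diamond property, and the two commute. -/

theorem shift_shift (M : Term) : ∀ {c d : ℕ}, c ≤ d →
    shift (d + 1) (shift c M) = shift c (shift d M) := by
  induction M with
  | var n =>
    intro c d h
    simp only [shift]
    split_ifs <;> simp only [shift] <;> split_ifs <;> first | rfl | omega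
  | lam M ih => intro c d h; simp only [shift, ih (Nat.succ_le_succ h)]
  | app M N ihM ihN => intro c d h; simp only [shift, ihM h, ihN h]

theorem subst_shift (M : Term) : ∀ (k : ℕ) (N : Term), subst k N (shift k M) = M := by
  induction M with
  | var n =>
    intro k N
    simp only [shift]
    split_ifs <;> simp only [subst] <;> split_ifs <;> first | rfl | omega
  | lam M ih => intro k N; simp only [shift, subst, ih]
  | app M P ihM ihP => intro k N; simp only [shift, subst, ihM, ihP]

theorem shift_subst_of_le (M : Term) : ∀ {c k : ℕ} (N : Term), c ≤ k →
    shift c (subst k N M) = subst (k + 1) (shift c N) (shift c M) := by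
  induction M with
  | var n =>
    intro c k N h
    simp only [shift, subst]
    split_ifs <;> simp only [shift, subst] <;> split_ifs <;>
      first | rfl | omega | (congr 1; omega)
  | lam M ih =>
    intro c k N h
    simp only [shift, subst, ih _ (Nat.succ_le_succ h), shift_shift N (Nat.zero_le c)]
  | app M P ihM ihP => intro c k N h; simp only [shift, subst, ihM _ h, ihP _ h]

theorem shift_subst_of_ge (M : Term) : ∀ {c k : ℕ} (N : Term), k ≤ c →
    shift c (subst k N M) = subst k (shift c N) (shift (c + 1) M) := by
  induction M with
  | var n =>
    intro c k N h
    simp only [shift, subst]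
    split_ifs <;> simp only [shift, subst] <;> split_ifs <;>
      first | rfl | omega | (congr 1; omega)
  | lam M ih =>
    intro c k N h
    simp only [shift, subst, ih _ (Nat.succ_le_succ h), shift_shift N (Nat.zero_le c)]
  | app M P ihM ihP => intro c k N h; simp only [shift, subst, ihM _ h, ihP _ h]

theorem subst_subst (M : Term) : ∀ {j k : ℕ} (N P : Term), j ≤ k →
    subst k P (subst j N M) = subst j (subst k P N) (subst (k + 1) (shift j P) M) := by
  induction M with
  | var n =>
    intro j k N P h
    simp only [subst]
    split_ifs <;> (try simp only [subst]) <;> (try split_ifs) <;>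
      first | rfl | omega | exact (subst_shift _ _ _).symm
  | lam M ih =>
    intro j k N P h
    simp only [subst, ih _ _ (Nat.succ_le_succ h), shift_subst_of_le N P (Nat.zero_le k),
      shift_shift P (Nat.zero_le j)]
  | app M Q ihM ihQ => intro j k N P h; simp only [subst, ihM _ _ h, ihQ _ _ h]

theorem IsValue.shift {V : Term} (h : IsValue V) (c : ℕ) : IsValue (V.shift c) := by
  cases h with
  | var n => simp only [Term.shift]; split_ifs <;> exact .var _
  | lam M => exact .lam _

theorem IsValue.subst {V W : Term} (h : IsValue V) (hW : IsValue W) (k : ℕ) :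
    IsValue (Term.subst k W V) := by
  cases h with
  | var n => simp only [Term.subst]; split_ifs <;> first | exact .var _ | exact hW
  | lam M => exact .lam _

theorem not_isValue_app {M N : Term} : ¬ IsValue (app M N) := nofun

/-! ### Structural part of the reduction -/

/-- The contextual closure of the rules `σ₁` and `σ₃`. -/
inductive Sig : Term → Term → Prop
  | sigma1 (M N P : Term) : Sig (app (app (lam M) N) P) (app (lam (app M (shift 0 P))) N)
  | sigma3 (V M N : Term) : IsValue V →
      Sig (app V (app (lam M) N)) (app (lam (app (shift 0 V) M)) N)
  | lam {M M' : Term} : Sig M M' → Sig (lam M) (lam M')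
  | appL {M M' : Term} (N : Term) : Sig M M' → Sig (app M N) (app M' N)
  | appR (M : Term) {N N' : Term} : Sig N N' → Sig (app M N) (app M N')

/-- The reflexive transitive closure of `Sig`. -/
abbrev Sigs : Term → Term → Prop := Relation.ReflTransGen Sig

/-- Parallel `β_v`-reduction. -/
inductive Par : Term → Term → Prop
  | var (n : ℕ) : Par (var n) (var n)
  | lam {M M' : Term} : Par M M' → Par (lam M) (lam M')
  | app {M M' N N' : Term} : Par M M' → Par N N' → Par (app M N) (app M' N')
  | beta {M M' V V' : Term} : Par M M' → Par V V' → IsValue V →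
      Par (app (lam M) V) (subst 0 V' M')

theorem Par.refl : ∀ M : Term, Par M M
  | .var n => .var n
  | .lam M => .lam (refl M)
  | .app M N => .app (refl M) (refl N)

theorem IsValue.step {V V' : Term} (hV : IsValue V) (h : Step V V') : IsValue V' := by
  cases hV <;> cases h; exact .lam _

theorem IsValue.steps {V V' : Term} (hV : IsValue V) (h : Steps V V') : IsValue V' := by
  induction h with
  | refl => exact hV
  | tail _ h ih => exact ih.step h

theorem IsValue.sig {V V' : Term} (hV : IsValue V) (h : Sig V V') : IsValue V' := by
  cases hV <;> cases h; exact .lam _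

theorem IsValue.par {V V' : Term} (hV : IsValue V) (h : Par V V') : IsValue V' := by
  cases hV <;> cases h
  · exact .var _
  · exact .lam _

theorem Steps.lam {M M' : Term} (h : Steps M M') : Steps (lam M) (lam M') :=
  Relation.ReflTransGen.lift Term.lam (fun _ _ => Step.lam) _ _ h

theorem Steps.app {M M' N N' : Term} (h : Steps M M') (h' : Steps N N') :
    Steps (app M N) (app M' N') :=
  (Relation.ReflTransGen.lift (fun M => Term.app M N) (fun _ _ => Step.appL N) _ _ h).trans
    (Relation.ReflTransGen.lift (Term.app M') (fun _ _ => Step.appR M') _ _ h')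

theorem Sigs.lam {M M' : Term} (h : Sigs M M') : Sigs (lam M) (lam M') :=
  Relation.ReflTransGen.lift Term.lam (fun _ _ => Sig.lam) _ _ h

theorem Sigs.app {M M' N N' : Term} (h : Sigs M M') (h' : Sigs N N') :
    Sigs (app M N) (app M' N') :=
  (Relation.ReflTransGen.lift (fun M => Term.app M N) (fun _ _ => Sig.appL N) _ _ h).trans
    (Relation.ReflTransGen.lift (Term.app M') (fun _ _ => Sig.appR M') _ _ h')

theorem Step.shift {M N : Term} (h : Step M N) : ∀ c, Step (M.shift c) (N.shift c) := by
  induction h with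
  | beta M V hV =>
    intro c
    rw [shift_subst_of_ge M V (Nat.zero_le c)]
    exact .beta _ _ (hV.shift c)
  | sigma1 M N P =>
    intro c
    simp only [Term.shift, shift_shift P (Nat.zero_le c)]
    exact .sigma1 _ _ _
  | sigma3 V M N hV =>
    intro c
    simp only [Term.shift, shift_shift V (Nat.zero_le c)]
    exact .sigma3 _ _ _ (hV.shift c)
  | lam _ ih => exact fun c => .lam (ih _)
  | appL N _ ih => exact fun c => .appL _ (ih _)
  | appR M _ ih => exact fun c => .appR _ (ih _)

theorem Step.subst {M N : Term} (h : Step M N) :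
    ∀ {V : Term} (k : ℕ), IsValue V → Step (Term.subst k V M) (Term.subst k V N) := by
  induction h with
  | beta M W hW =>
    intro V k hV
    rw [subst_subst M W V (Nat.zero_le k)]
    exact .beta _ _ (hW.subst hV k)
  | sigma1 M N P =>
    intro V k hV
    simp only [Term.subst, ← shift_subst_of_le P V (Nat.zero_le k)]
    exact .sigma1 _ _ _
  | sigma3 W M N hW =>
    intro V k hV
    simp only [Term.subst, ← shift_subst_of_le W V (Nat.zero_le k)]
    exact .sigma3 _ _ _ (hW.subst hV k)
  | lam _ ih => exact fun k hV => .lam (ih _ (hV.shift 0))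
  | appL N _ ih => exact fun k hV => .appL _ (ih _ hV)
  | appR M _ ih => exact fun k hV => .appR _ (ih _ hV)

theorem Steps.shift {M N : Term} (h : Steps M N) (c : ℕ) : Steps (M.shift c) (N.shift c) :=
  Relation.ReflTransGen.lift (Term.shift c) (fun _ _ h => h.shift c) _ _ h

theorem Steps.subst {M N V : Term} (h : Steps M N) (k : ℕ) (hV : IsValue V) :
    Steps (Term.subst k V M) (Term.subst k V N) :=
  Relation.ReflTransGen.lift (Term.subst k V) (fun _ _ h => h.subst k hV) _ _ h

theorem Sig.shift {M N : Term} (h : Sig M N) : ∀ c, Sig (M.shift c) (N.shift c) := by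
  induction h with
  | sigma1 M N P =>
    intro c
    simp only [Term.shift, shift_shift P (Nat.zero_le c)]
    exact .sigma1 _ _ _
  | sigma3 V M N hV =>
    intro c
    simp only [Term.shift, shift_shift V (Nat.zero_le c)]
    exact .sigma3 _ _ _ (hV.shift c)
  | lam _ ih => exact fun c => .lam (ih _)
  | appL N _ ih => exact fun c => .appL _ (ih _)
  | appR M _ ih => exact fun c => .appR _ (ih _)

theorem Sig.subst {M N : Term} (h : Sig M N) :
    ∀ {V : Term} (k : ℕ), IsValue V → Sig (Term.subst k V M) (Term.subst k V N) := by
  induction h with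
  | sigma1 M N P =>
    intro V k hV
    simp only [Term.subst, ← shift_subst_of_le P V (Nat.zero_le k)]
    exact .sigma1 _ _ _
  | sigma3 W M N hW =>
    intro V k hV
    simp only [Term.subst, ← shift_subst_of_le W V (Nat.zero_le k)]
    exact .sigma3 _ _ _ (hW.subst hV k)
  | lam _ ih => exact fun k hV => .lam (ih _ (hV.shift 0))
  | appL N _ ih => exact fun k hV => .appL _ (ih _ hV)
  | appR M _ ih => exact fun k hV => .appR _ (ih _ hV)

theorem Sigs.shift {M N : Term} (h : Sigs M N) (c : ℕ) : Sigs (M.shift c) (N.shift c) :=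
  Relation.ReflTransGen.lift (Term.shift c) (fun _ _ h => h.shift c) _ _ h

theorem Sigs.subst {M N V : Term} (h : Sigs M N) (k : ℕ) (hV : IsValue V) :
    Sigs (Term.subst k V M) (Term.subst k V N) :=
  Relation.ReflTransGen.lift (Term.subst k V) (fun _ _ h => h.subst k hV) _ _ h

/-- The substituted value may be copied or erased, so even a single step in it becomes a sequence of
steps of arbitrary length. -/
theorem Sigs.subst_right (M : Term) : ∀ {V V' : Term} (k : ℕ), Sigs V V' →
    Sigs (Term.subst k V M) (Term.subst k V' M) := by
  induction M with
  | var n =>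
    intro V V' k h
    simp only [Term.subst]
    split_ifs
    exacts [h, .refl, .refl]
  | lam M ih => exact fun k h => (ih _ (h.shift 0)).lam
  | app M N ihM ihN => exact fun k h => (ihM k h).app (ihN k h)

theorem Par.shift {M N : Term} (h : Par M N) : ∀ c, Par (M.shift c) (N.shift c) := by
  induction h with
  | var n => exact fun c => .refl _
  | lam _ ih => exact fun c => .lam (ih _)
  | app _ _ ih ih' => exact fun c => .app (ih _) (ih' _)
  | beta _ _ hV ih ih' =>
    intro c
    rw [shift_subst_of_ge _ _ (Nat.zero_le c)]
    exact .beta (ih _) (ih' _) (hV.shift c)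

theorem Par.subst {M N : Term} (h : Par M N) : ∀ {V V' : Term} (k : ℕ), IsValue V → Par V V' →
    Par (Term.subst k V M) (Term.subst k V' N) := by
  induction h with
  | var n =>
    intro V V' k _ h
    simp only [Term.subst]
    split_ifs
    exacts [h, .refl _, .refl _]
  | lam _ ih => exact fun k hV h => .lam (ih _ (hV.shift 0) (h.shift 0))
  | app _ _ ih ih' => exact fun k hV h => .app (ih _ hV h) (ih' _ hV h)
  | beta _ _ hW ih ih' =>
    intro V V' k hV h
    rw [subst_subst _ _ _ (Nat.zero_le k)]
    exact .beta (ih _ (hV.shift 0) (h.shift 0)) (ih' _ hV h) (hW.subst hV k)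

theorem Par.diamond {M N : Term} (h : Par M N) :
    ∀ {P : Term}, Par M P → ∃ Q, Par N Q ∧ Par P Q := by
  induction h with
  | var n => exact fun h => ⟨_, h, .refl _⟩
  | lam _ ih =>
    intro P h
    cases h with
    | lam h => obtain ⟨Q, h₁, h₂⟩ := ih h; exact ⟨_, .lam h₁, .lam h₂⟩
  | @app M M' N N' h₁ h₂ ih ih' =>
    intro P h
    cases h with
    | app h h' =>
      obtain ⟨Q, h₁, h₂⟩ := ih h
      obtain ⟨Q', h₁', h₂'⟩ := ih' h'
      exact ⟨_, .app h₁ h₁', .app h₂ h₂'⟩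
    | beta h h' hV =>
      -- The induction hypothesis concerns the whole function part, so the reduct of the body is
      -- wrapped in its abstraction and the common reduct is unwrapped afterwards.
      obtain ⟨Q, h₁', h₂⟩ := ih (.lam h)
      obtain ⟨Q', h₁'', h₂'⟩ := ih' h'
      cases h₁; cases h₂; cases h₁'
      exact ⟨_, .beta ‹_› h₁'' (hV.par ‹_›), .subst ‹_› _ (hV.par h') ‹_›⟩
  | @beta M M' V V' h₁ h₂ hV ih ih' =>
    intro P h
    cases h with
    | app h h' =>
      cases h with
      | lam h =>
        obtain ⟨Q, h₁', h₂'⟩ := ih h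
        obtain ⟨Q', h₁'', h₂''⟩ := ih' h'
        exact ⟨_, .subst h₁' _ (hV.par h₂) h₁'', .beta h₂' h₂'' (hV.par h')⟩
    | beta h h' _ =>
      obtain ⟨Q, h₁', h₂'⟩ := ih h
      obtain ⟨Q', h₁'', h₂''⟩ := ih' h'
      exact ⟨_, .subst h₁' _ (hV.par h₂) h₁'', .subst h₂' _ (hV.par h') h₂''⟩

/-- Parallel `β_v`-reduction commutes with the structural reduction. -/
theorem Par.sig_comm {M N : Term} (h : Par M N) :
    ∀ {P : Term}, Sig M P → ∃ Q, Sigs N Q ∧ Par P Q := by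
  induction h with
  | var n => exact fun h => nomatch h
  | lam _ ih =>
    intro P h
    cases h with
    | lam h => obtain ⟨Q, h₁, h₂⟩ := ih h; exact ⟨_, h₁.lam, .lam h₂⟩
  | @app M M' N N' h₁ h₂ ih ih' =>
    intro P h
    cases h with
    | appL _ h => obtain ⟨Q, h₃, h₄⟩ := ih h; exact ⟨_, h₃.app .refl, .app h₄ h₂⟩
    | appR _ h => obtain ⟨Q, h₃, h₄⟩ := ih' h; exact ⟨_, .app .refl h₃, .app h₁ h₄⟩
    | sigma1 A B _ =>
      cases h₁ with
      | app h h' =>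
        cases h with
        | lam h => exact ⟨_, .single (.sigma1 _ _ _), .app (.lam (.app h (h₂.shift 0))) h'⟩
      | @beta _ A' _ B' h h' hV =>
        -- The argument of the inner redex is a value and has already been consumed. After the
        -- permutation the same redex sits at the root, and the displaced argument, being shifted,
        -- is untouched by the substitution.
        refine ⟨_, .refl, ?_⟩
        have := Par.beta (.app h (h₂.shift 0)) h' hV
        rwa [Term.subst, subst_shift] at this
    | sigma3 _ A B hV =>
      cases h₂ with
      | app h h' =>
        cases h with
        | lam h =>
          exact ⟨_, .single (.sigma3 _ _ _ (hV.par h₁)), .app (.lam (.app (h₁.shift 0) h)) h'⟩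
      | @beta _ A' _ B' h h' hW =>
        refine ⟨_, .refl, ?_⟩
        have := Par.beta (.app (h₁.shift 0) h) h' hW
        rwa [Term.subst, subst_shift] at this
  | @beta M M' V V' h₁ h₂ hV ih ih' =>
    intro P h
    cases h with
    | appL _ h =>
      cases h with
      | lam h =>
        obtain ⟨Q, h₃, h₄⟩ := ih h
        exact ⟨_, h₃.subst 0 (hV.par h₂), .beta h₄ h₂ hV⟩
    | appR _ h =>
      obtain ⟨Q, h₃, h₄⟩ := ih' h
      exact ⟨_, h₃.subst_right _ 0, .beta h₁ h₄ (hV.sig h)⟩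
    | sigma3 => exact (not_isValue_app hV).elim

/-- In the one-step commutation the parallel step remains a single step, so the squares can be
pasted along the structural sequence. -/
theorem Par.sigs_comm {M P : Term} (h : Sigs M P) :
    ∀ {N : Term}, Par M N → ∃ Q, Sigs N Q ∧ Par P Q := by
  induction h using Relation.ReflTransGen.head_induction_on with
  | refl => exact fun h => ⟨_, .refl, h⟩
  | head h _ ih =>
    intro N h'
    obtain ⟨Q, h₁, h₂⟩ := h'.sig_comm h
    obtain ⟨Q', h₃, h₄⟩ := ih h₂
    exact ⟨Q', h₁.trans h₃, h₄⟩

/-! ### Confluence of the structural part -/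

/-- A measure that decreases along the structural reduction. -/
def weight : Term → ℕ
  | var _ => 2
  | lam M => M.weight + 1
  | app M N => M.weight * N.weight

theorem two_le_weight : ∀ M : Term, 2 ≤ M.weight
  | var _ => le_rfl
  | lam M => (two_le_weight M).trans (Nat.le_succ _)
  | app M N => by
    have := Nat.mul_le_mul (two_le_weight M) (two_le_weight N)
    simp only [weight]; omega

@[simp] theorem weight_shift (M : Term) : ∀ c, (M.shift c).weight = M.weight := by
  induction M with
  | var n => intro c; simp only [shift]; split_ifs <;> rfl
  | lam M ih => intro c; simp only [shift, weight, ih]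
  | app M N ih ih' => intro c; simp only [shift, weight, ih, ih']

/-- A permutation moves a factor `p` inside an abstraction: `(m + 1) * n * p` becomes `(m * p + 1) *
n`, which is smaller because `p ≥ 2`. -/
theorem Sig.weight_lt {M N : Term} (h : Sig M N) : N.weight < M.weight := by
  induction h with
  | sigma1 M N P =>
    simp only [weight, weight_shift]
    have := two_le_weight N
    have := two_le_weight P
    have : N.weight * 2 ≤ N.weight * P.weight := Nat.mul_le_mul_left _ ‹_›
    nlinarith
  | sigma3 V M N _ =>
    simp only [weight, weight_shift]
    have := two_le_weight N
    have := two_le_weight V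
    have : N.weight * 2 ≤ N.weight * V.weight := Nat.mul_le_mul_left _ ‹_›
    nlinarith
  | lam _ ih => exact Nat.succ_lt_succ ih
  | appL N _ ih => exact Nat.mul_lt_mul_of_pos_right ih (by have := two_le_weight N; omega)
  | appR M _ ih => exact Nat.mul_lt_mul_of_pos_left ih (by have := two_le_weight M; omega)

/-- The contractions at the root. -/
inductive SigRoot : Term → Term → Prop
  | sigma1 (M N P : Term) : SigRoot (app (app (lam M) N) P) (app (lam (app M (shift 0 P))) N)
  | sigma3 (V M N : Term) : IsValue V →
      SigRoot (app V (app (lam M) N)) (app (lam (app (shift 0 V) M)) N)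

/-- Isolating the case where one of the two contractions is at the root lets each overlap be treated
once; `Sig.local_confl` obtains the mirror cases by symmetry. -/
theorem SigRoot.local_confl {M N P : Term} (h : SigRoot M N) (h' : Sig M P) :
    ∃ Q, Sigs N Q ∧ Sigs P Q := by
  cases h with
  | sigma1 M N R =>
    cases h' with
    | sigma1 => exact ⟨_, .refl, .refl⟩
    | sigma3 _ _ _ hV => exact (not_isValue_app hV).elim
    | appR _ h => exact ⟨_, .single (.appL _ (.lam (.appR _ (h.shift 0)))), .single (.sigma1 _ _ _)⟩
    | appL _ h =>
      cases h with
      | appR _ h => exact ⟨_, .single (.appR _ h), .single (.sigma1 _ _ _)⟩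
      | appL _ h =>
        cases h with
        | lam h => exact ⟨_, .single (.appL _ (.lam (.appL _ h))), .single (.sigma1 _ _ _)⟩
      | sigma3 _ A B hV =>
        -- Critical pair on `(λM)((λA)B) R`: both sides meet at `(λ.(λ.M R) A) B`, the side
        -- contracted inside needing `σ₁` twice, at the root and then under the abstraction.
        refine ⟨_, .single (.sigma3 _ _ _ (.lam _)),
          .head (.sigma1 _ _ _) (.single (.appL _ (.lam ?_)))⟩
        simp only [shift, shift_shift R (Nat.zero_le 0)]
        exact .sigma1 _ _ _
  | sigma3 V M N hV =>
    cases h' with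
    | sigma1 => exact (not_isValue_app hV).elim
    | sigma3 => exact ⟨_, .refl, .refl⟩
    | appL _ h =>
      exact ⟨_, .single (.appL _ (.lam (.appL _ (h.shift 0)))), .single (.sigma3 _ _ _ (hV.sig h))⟩
    | appR _ h =>
      cases h with
      | appR _ h => exact ⟨_, .single (.appR _ h), .single (.sigma3 _ _ _ hV)⟩
      | appL _ h =>
        cases h with
        | lam h => exact ⟨_, .single (.appL _ (.lam (.appR _ h))), .single (.sigma3 _ _ _ hV)⟩
      | sigma3 _ A B _ =>
        -- Critical pair on `V ((λM)((λA)B))`, closed in the same way with `σ₃` twice.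
        refine ⟨_, .single (.sigma3 _ _ _ (.lam _)),
          .head (.sigma3 _ _ _ hV) (.single (.appL _ (.lam ?_)))⟩
        simp only [shift, shift_shift V (Nat.zero_le 0)]
        exact .sigma3 _ _ _ (hV.shift 0)

theorem Sig.local_confl {M N : Term} (h : Sig M N) :
    ∀ {P : Term}, Sig M P → ∃ Q, Sigs N Q ∧ Sigs P Q := by
  induction h with
  | sigma1 M N R => exact SigRoot.local_confl (.sigma1 _ _ _)
  | sigma3 V M N hV => exact SigRoot.local_confl (.sigma3 _ _ _ hV)
  | lam _ ih =>
    intro P h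
    cases h with
    | lam h => obtain ⟨Q, h₁, h₂⟩ := ih h; exact ⟨_, h₁.lam, h₂.lam⟩
  | @appL M M' N h ih =>
    intro P h'
    have root : SigRoot (app M N) P → ∃ Q, Sigs (app M' N) Q ∧ Sigs P Q := fun hr =>
      (hr.local_confl (.appL N h)).imp fun _ => And.symm
    cases h' with
    | sigma1 => exact root (.sigma1 _ _ _)
    | sigma3 _ _ _ hV => exact root (.sigma3 _ _ _ hV)
    | appL _ h' => obtain ⟨Q, h₁, h₂⟩ := ih h'; exact ⟨_, h₁.app .refl, h₂.app .refl⟩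
    | appR _ h' => exact ⟨_, .single (.appR _ h'), .single (.appL _ h)⟩
  | @appR M N N' h ih =>
    intro P h'
    have root : SigRoot (app M N) P → ∃ Q, Sigs (app M N') Q ∧ Sigs P Q := fun hr =>
      (hr.local_confl (.appR M h)).imp fun _ => And.symm
    cases h' with
    | sigma1 => exact root (.sigma1 _ _ _)
    | sigma3 _ _ _ hV => exact root (.sigma3 _ _ _ hV)
    | appL _ h' => exact ⟨_, .single (.appL _ h'), .single (.appR _ h)⟩
    | appR _ h' => obtain ⟨Q, h₁, h₂⟩ := ih h'; exact ⟨_, .app .refl h₁, .app .refl h₂⟩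

/-- Newman's lemma, with `weight` as the termination measure. -/
theorem Sigs.confluent {M N P : Term} (h : Sigs M N) (h' : Sigs M P) :
    ∃ Q, Sigs N Q ∧ Sigs P Q := by
  induction hn : M.weight using Nat.strong_induction_on generalizing M N P with
  | _ n ih =>
    subst hn
    rcases h.cases_head with rfl | ⟨N₁, hN₁, hN⟩
    · exact ⟨P, h', .refl⟩
    rcases h'.cases_head with rfl | ⟨P₁, hP₁, hP⟩
    · exact ⟨N, .refl, h⟩
    obtain ⟨Q, h₁, h₂⟩ := hN₁.local_confl hP₁
    obtain ⟨Q₁, h₃, h₄⟩ := ih _ hN₁.weight_lt hN h₁ rfl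
    obtain ⟨Q₂, h₅, h₆⟩ := ih _ hP₁.weight_lt hP (h₂.trans h₄) rfl
    exact ⟨Q₂, h₃.trans h₆, h₅⟩

/-! ### Confluence -/

/-- Structural reduction followed by parallel `β_v`-reduction. -/
def SigPar (M N : Term) : Prop := ∃ P, Sigs M P ∧ Par P N

/-- Four tiles: confluence of the structural parts, two commutation squares, and the diamond of
parallel `β_v` in the last corner. -/
theorem SigPar.diamond {M N P : Term} (h : SigPar M N) (h' : SigPar M P) :
    ∃ Q, SigPar N Q ∧ SigPar P Q := by
  obtain ⟨N₁, h₁, h₂⟩ := h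
  obtain ⟨P₁, h₃, h₄⟩ := h'
  obtain ⟨R, h₅, h₆⟩ := h₁.confluent h₃
  obtain ⟨N₂, h₇, h₈⟩ := Par.sigs_comm h₅ h₂
  obtain ⟨P₂, h₉, h₁₀⟩ := Par.sigs_comm h₆ h₄
  obtain ⟨Q, h₁₁, h₁₂⟩ := h₈.diamond h₁₀
  exact ⟨Q, ⟨_, h₇, h₁₁⟩, ⟨_, h₉, h₁₂⟩⟩

theorem Sig.step {M N : Term} (h : Sig M N) : Step M N := by
  induction h with
  | sigma1 M N P => exact .sigma1 _ _ _
  | sigma3 V M N hV => exact .sigma3 _ _ _ hV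
  | lam _ ih => exact .lam ih
  | appL N _ ih => exact .appL _ ih
  | appR M _ ih => exact .appR _ ih

theorem Par.steps {M N : Term} (h : Par M N) : Steps M N := by
  induction h with
  | var n => exact .refl
  | lam _ ih => exact ih.lam
  | app _ _ ih ih' => exact ih.app ih'
  | beta _ h hV ih ih' => exact (ih.lam.app ih').tail (.beta _ _ (hV.par h))

theorem Step.par_or_sig {M N : Term} (h : Step M N) : Par M N ∨ Sig M N := by
  induction h with
  | beta M V hV => exact .inl (.beta (.refl _) (.refl _) hV)
  | sigma1 M N P => exact .inr (.sigma1 _ _ _)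
  | sigma3 V M N hV => exact .inr (.sigma3 _ _ _ hV)
  | lam _ ih => exact ih.imp .lam .lam
  | appL N _ ih => exact ih.imp (.app · (.refl _)) (.appL _)
  | appR M _ ih => exact ih.imp (.app (.refl _)) (.appR _)

/-- Confluence of the call-by-value reduction with permutation rules. -/
theorem Steps.confluent {M N P : Term} (h : Steps M N) (h' : Steps M P) :
    ∃ Q, Steps N Q ∧ Steps P Q := by
  have sp : ∀ {M N}, Steps M N → Relation.ReflTransGen SigPar M N :=
    -- `SigPar` lies between `Step` and `Steps`, so all three have the same reflexive transitive
    -- closure.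
    fun h => Relation.ReflTransGen.mono (fun M N (h : Step M N) => h.par_or_sig.elim
      (fun h => ⟨_, .refl, h⟩) (fun h => ⟨_, .single h, .refl _⟩)) _ _ h
  have ps : ∀ {M N}, Relation.ReflTransGen SigPar M N → Steps M N := by
    intro M N h
    induction h with
    | refl => exact .refl
    | tail _ h ih =>
      obtain ⟨P, h₁, h₂⟩ := h
      exact (ih.trans (Relation.ReflTransGen.mono (fun _ _ => Sig.step) _ _ h₁)).trans h₂.steps
  obtain ⟨Q, h₁, h₂⟩ := Relation.church_rosser (r := SigPar) (fun a b c hb hc => by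
    obtain ⟨d, h₁, h₂⟩ := hb.diamond hc
    exact ⟨d, .single h₁, .single h₂⟩) (sp h) (sp h')
  exact ⟨Q, ps h₁, ps h₂⟩

end Term
-- Taylor expansion as a relation between resource expressions and terms.
namespace Pre

/-- Membership in the Taylor expansion of a lambda-term, for expressions of all kinds. -/
def InT : {κ : Kind} → Pre κ → Term → Prop
  | _, var n, M => M = .var n
  | _, lam t, M => ∃ N, M = .lam N ∧ InT t N
  | _, app s t, M => ∃ P Q, M = .app P Q ∧ InT s P ∧ InT t Q
  | _, bag b, M => M.IsValue ∧ InT b M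
  | _, nil, _ => True
  | _, cons v b, M => InT v M ∧ InT b M

/-- The terms with `⊥` that are expanded into bags. -/
inductive BotValue : BotTerm → Prop
  | bot : BotValue .bot
  | var (n : ℕ) : BotValue (.var n)
  | lam (A : BotTerm) : BotValue (.lam A)

/-- Membership in the Taylor expansion of a term with `⊥`, for expressions of all kinds. -/
def InTB : {κ : Kind} → Pre κ → BotTerm → Prop
  | _, var n, A => A = .var n
  | _, lam t, A => ∃ B, A = .lam B ∧ InTB t B
  | _, app s t, A => ∃ B C, A = .app B C ∧ InTB s B ∧ InTB t C
  | _, bag b, A => BotValue A ∧ InTB b A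
  | _, nil, _ => True
  | _, cons v b, A => InTB v A ∧ InTB b A

/-- Approximation of a lambda-term up to reduction: as `InT`, but the term may be reduced before
each of its constructors is inspected. -/
def Approx : {κ : Kind} → Pre κ → Term → Prop
  | _, var n, M => M = .var n
  | _, lam t, M => ∃ N, M = .lam N ∧ Approx t N
  | _, app s t, M => ∃ P Q, M.Steps (.app P Q) ∧ Approx s P ∧ Approx t Q
  | _, bag b, M => ∃ V, V.IsValue ∧ M.Steps V ∧ Approx b V
  | _, nil, _ => True
  | _, cons v b, M => Approx v M ∧ Approx b M

theorem Equiv.inTB_iff {κ : Kind} {e e' : Pre κ} (h : Equiv e e') :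
    ∀ A, InTB e A ↔ InTB e' A := by
  induction h with
  | refl => exact fun _ => .rfl
  | symm _ ih => exact fun M => (ih M).symm
  | trans _ _ ih ih' => exact fun M => (ih M).trans (ih' M)
  | swap => intro M; simp only [InTB]; tauto
  | lam _ ih => intro M; simp only [InTB, ih]
  | app _ _ ih ih' => intro M; simp only [InTB, ih, ih']
  | bag _ ih => intro M; simp only [InTB, ih]
  | cons _ _ ih ih' => intro M; simp only [InTB, ih, ih']

theorem Equiv.approx_iff {κ : Kind} {e e' : Pre κ} (h : Equiv e e') :
    ∀ M, Approx e M ↔ Approx e' M := by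
  induction h with
  | refl => exact fun _ => .rfl
  | symm _ ih => exact fun M => (ih M).symm
  | trans _ _ ih ih' => exact fun M => (ih M).trans (ih' M)
  | swap => intro M; simp only [Approx]; tauto
  | lam _ ih => intro M; simp only [Approx, ih]
  | app _ _ ih ih' => intro M; simp only [Approx, ih, ih']
  | bag _ ih => intro M; simp only [Approx, ih]
  | cons _ _ ih ih' => intro M; simp only [Approx, ih, ih']

theorem inT_bag_iff {b : Pre .bag} {M : Term} : InT b M ↔ ∀ v ∈ b.toList, InT v M := by
  refine Pre.rec (motive := fun κ e => match κ, e with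
    | .bag, b => InT b M ↔ ∀ v ∈ b.toList, InT v M
    | .val, _ => True
    | .tm, _ => True) ?_ ?_ ?_ ?_ ?_ ?_ b
  all_goals intros; simp_all [InT, toList]

theorem approx_bag_iff {b : Pre .bag} {M : Term} :
    Approx b M ↔ ∀ v ∈ b.toList, Approx v M := by
  refine Pre.rec (motive := fun κ e => match κ, e with
    | .bag, b => Approx b M ↔ ∀ v ∈ b.toList, Approx v M
    | .val, _ => True
    | .tm, _ => True) ?_ ?_ ?_ ?_ ?_ ?_ b
  all_goals intros; simp_all [Approx, toList]

theorem mem_taylor_iff {M : Term} : ∀ {s : Pre .tm}, s ∈ taylor M ↔ InT s M := by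
  induction M with
  | var n =>
    intro s
    cases s with
    | app => simp [taylor, InT]
    | bag b =>
      simp only [taylor, Set.mem_ofPred_eq, InT, inT_bag_iff, bag.injEq, exists_eq_left',
        Term.IsValue.var, true_and]
      refine forall₂_congr fun v _ => ?_
      cases v <;> simp [InT, eq_comm]
  | lam N ih =>
    intro s
    cases s with
    | app => simp [taylor, InT]
    | bag b =>
      simp only [taylor, Set.mem_ofPred_eq, InT, inT_bag_iff, bag.injEq, exists_eq_left',
        Term.IsValue.lam, true_and]
      refine forall₂_congr fun v _ => ?_
      cases v <;> simp [InT, ih, eq_comm]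
  | app P Q ihP ihQ =>
    intro s
    cases s with
    | app s t => simp [taylor, InT, ihP, ihQ]
    | bag b => simp [taylor, InT, Term.not_isValue_app]

theorem inTB_toBot {κ : Kind} (e : Pre κ) : ∀ {M : Term}, InTB e M.toBot ↔ InT e M := by
  induction e with
  | var n => intro M; cases M <;> simp [InT, InTB, Term.toBot]
  | lam t ih => intro M; cases M <;> simp [InT, InTB, Term.toBot, ih]
  | app s t ih ih' => intro M; cases M <;> simp [InT, InTB, Term.toBot, ih, ih']
  | bag b ih =>
    intro M
    simp only [InT, InTB, ih]
    refine and_congr_left fun _ => ⟨fun h => ?_, fun h => ?_⟩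
    · cases M with
      | var n => exact .var _
      | lam M => exact .lam _
      | app M N => cases h
    · cases h <;> constructor
  | nil => simp [InT, InTB]
  | cons v b ih ih' => intro M; simp [InT, InTB, ih, ih']

theorem InT.approx {κ : Kind} {e : Pre κ} : ∀ {M : Term}, InT e M → Approx e M := by
  induction e with
  | var n => exact id
  | lam t ih => exact fun ⟨N, h, h'⟩ => ⟨N, h, ih h'⟩
  | app s t ih ih' => exact fun ⟨P, Q, h, h₁, h₂⟩ => ⟨P, Q, h ▸ .refl, ih h₁, ih' h₂⟩
  | bag b ih => exact fun h => ⟨_, h.1, .refl, ih h.2⟩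
  | nil => exact id
  | cons v b ih ih' => exact fun h => ⟨ih h.1, ih' h.2⟩

/-! ### Approximation up to reduction is preserved by the resource reduction -/

theorem Approx.of_steps {t : Pre .tm} {M N : Term} (h : M.Steps N) (ht : Approx t N) :
    Approx t M := by
  cases t with
  | app s t => obtain ⟨P, Q, h', h''⟩ := ht; exact ⟨P, Q, h.trans h', h''⟩
  | bag b => obtain ⟨V, hV, h', h''⟩ := ht; exact ⟨V, hV, h.trans h', h''⟩

theorem Approx.shift {κ : Kind} {e : Pre κ} :
    ∀ {M : Term} (c : ℕ), Approx e M → Approx (e.shift c) (M.shift c) := by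
  induction e with
  | var n =>
    rintro _ c rfl
    simp only [Pre.shift, Term.shift]
    split_ifs <;> rfl
  | lam t ih => rintro _ c ⟨N, rfl, h⟩; exact ⟨_, rfl, ih _ h⟩
  | app s t ih ih' => rintro _ c ⟨P, Q, h, h₁, h₂⟩; exact ⟨_, _, h.shift c, ih _ h₁, ih' _ h₂⟩
  | bag b ih => rintro _ c ⟨V, hV, h, h'⟩; exact ⟨_, hV.shift c, h.shift c, ih _ h'⟩
  | nil => exact fun _ _ => trivial
  | cons v b ih ih' => exact fun c h => ⟨ih c h.1, ih' c h.2⟩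

theorem Approx.plug {κ : Kind} {e : Pre κ} : ∀ {M V : Term} (k : ℕ) {vs : List (Pre .val)},
    Approx e M → V.IsValue → deg k e = vs.length → (∀ v ∈ vs, Approx v V) →
    Approx (plug k e vs) (Term.subst k V M) := by
  induction e with
  | var n =>
    rintro _ V k vs rfl hV hd hvs
    simp only [deg] at hd
    simp only [Pre.plug, Term.subst]
    split_ifs at hd ⊢ with h
    · obtain ⟨v, rfl⟩ := List.length_eq_one_iff.1 hd.symm
      exact hvs v (by simp)
    · rfl
    · rfl
  | lam t ih =>
    rintro _ V k vs ⟨N, rfl, h⟩ hV hd hvs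
    refine ⟨_, rfl, ih (k + 1) h (hV.shift 0) (by simpa [deg] using hd) fun v hv => ?_⟩
    obtain ⟨w, hw, rfl⟩ := List.mem_map.1 hv
    exact (hvs w hw).shift 0
  | app s t ih ih' =>
    rintro _ V k vs ⟨P, Q, h, h₁, h₂⟩ hV hd hvs
    simp only [deg] at hd
    exact ⟨_, _, h.subst k hV,
      ih k h₁ hV (by simp; omega) fun v hv => hvs v (List.mem_of_mem_take hv),
      ih' k h₂ hV (by simp; omega) fun v hv => hvs v (List.mem_of_mem_drop hv)⟩
  | bag b ih =>
    rintro _ V k vs ⟨W, hW, h, h'⟩ hV hd hvs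
    exact ⟨_, hW.subst hV k, h.subst k hV, ih k h' hV hd hvs⟩
  | nil => exact fun _ _ _ _ _ _ => trivial
  | cons v b ih ih' =>
    rintro _ V k vs ⟨h₁, h₂⟩ hV hd hvs
    simp only [deg] at hd
    exact ⟨ih k h₁ hV (by simp; omega) fun v hv => hvs v (List.mem_of_mem_take hv),
      ih' k h₂ hV (by simp; omega) fun v hv => hvs v (List.mem_of_mem_drop hv)⟩

/-- Each resource rule is matched by the corresponding rule on the term, which the reductions built
into `Approx` absorb. `InT` would not do: reducing one element of a bag and not its neighbours
leaves the expansion of any one term. -/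
theorem Approx.of_step {κ : Kind} {e : Pre κ} {E : Set (Pre κ)} (h : Step e E) :
    ∀ {M : Term}, Approx e M → ∀ e' ∈ E, Approx e' M := by
  induction h with
  | beta t b =>
    rintro M ⟨P, Q, hM, ⟨V, -, hP, ⟨N, rfl, ht⟩, -⟩, W, hW, hQ, hb⟩ _ ⟨hd, ws, hws, rfl⟩
    refine .of_steps ((hM.trans (hP.app hQ)).tail (.beta _ _ hW))
      (ht.plug 0 hW (hd.trans hws.length_eq.symm) fun v hv => ?_)
    exact approx_bag_iff.1 hb v (hws.mem_iff.1 hv)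
  | zero => exact fun _ _ h => h.elim
  | sigma1 t s₁ s₂ =>
    rintro M ⟨P, Q, hM, ⟨P₁, P₂, hP, ⟨V, -, hP₁, ⟨N, rfl, ht⟩, -⟩, hs₁⟩, hs₂⟩ _ rfl
    exact ⟨_, _, (hM.trans (Term.Steps.app (hP.trans (hP₁.app .refl)) .refl)).tail (.sigma1 _ _ _),
      ⟨_, .lam _, .refl, ⟨_, rfl, _, _, .refl, ht, hs₂.shift 0⟩, trivial⟩, hs₁⟩
  | sigma3 v t s =>
    rintro M ⟨P, Q, hM, ⟨W, hW, hP, hv, -⟩, Q₁, Q₂, hQ, ⟨V, -, hQ₁, ⟨N, rfl, ht⟩, -⟩, hs⟩ _ rfl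
    exact ⟨_, _, (hM.trans (hP.app (hQ.trans (hQ₁.app .refl)))).tail (.sigma3 _ _ _ hW),
      ⟨_, .lam _, .refl, ⟨_, rfl, _, _, .refl, ⟨_, hW.shift 0, .refl, hv.shift 0, trivial⟩, ht⟩,
        trivial⟩, hs⟩
  | lam _ ih => rintro M ⟨N, h, h'⟩ _ ⟨t, ht, rfl⟩; exact ⟨N, h, ih h' t ht⟩
  | appL _ _ ih => rintro M ⟨P, Q, h, h₁, h₂⟩ _ ⟨t, ht, rfl⟩; exact ⟨P, Q, h, ih h₁ t ht, h₂⟩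
  | appR _ _ ih => rintro M ⟨P, Q, h, h₁, h₂⟩ _ ⟨t, ht, rfl⟩; exact ⟨P, Q, h, h₁, ih h₂ t ht⟩
  | bag _ ih => rintro M ⟨V, hV, h, h'⟩ _ ⟨t, ht, rfl⟩; exact ⟨V, hV, h, ih h' t ht⟩
  | consHead _ _ ih => rintro M ⟨h₁, h₂⟩ _ ⟨t, ht, rfl⟩; exact ⟨ih h₁ t ht, h₂⟩
  | consTail _ _ ih => rintro M ⟨h₁, h₂⟩ _ ⟨t, ht, rfl⟩; exact ⟨h₁, ih h₂ t ht⟩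

/-! ### Irreducible expressions -/

/-- No reduction step is possible. -/
def Irr {κ : Kind} (e : Pre κ) : Prop := ∀ E, ¬ Step e E

theorem Irr.lam {t : Pre .tm} (h : Irr (lam t)) : Irr t := fun _ h' => h _ (.lam h')
theorem Irr.appL {s t : Pre .tm} (h : Irr (app s t)) : Irr s := fun _ h' => h _ (.appL _ h')
theorem Irr.appR {s t : Pre .tm} (h : Irr (app s t)) : Irr t := fun _ h' => h _ (.appR _ h')
theorem Irr.bag {b : Pre .bag} (h : Irr (bag b)) : Irr b := fun _ h' => h _ (.bag h')
theorem Irr.head {v : Pre .val} {b : Pre .bag} (h : Irr (cons v b)) : Irr v :=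
  fun _ h' => h _ (.consHead _ h')
theorem Irr.tail {v : Pre .val} {b : Pre .bag} (h : Irr (cons v b)) : Irr b :=
  fun _ h' => h _ (.consTail _ h')

theorem toList_eq_singleton {b : Pre .bag} (h : b.toList.length = 1) : ∃ v, b = cons v nil := by
  cases b with
  | nil => simp [toList] at h
  | cons v b =>
    cases b with
    | nil => exact ⟨v, rfl⟩
    | cons w b => simp [toList] at h

theorem Irr.singleton {b : Pre .bag} {t : Pre .tm} (h : Irr (app (.bag b) t)) :
    ∃ v, b = cons v nil := by
  by_contra hb
  exact h _ (.zero b t fun h' => hb (toList_eq_singleton h'))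

/-- An irreducible expansion of a function that is an abstraction. -/
theorem Irr.fun_lam {s t : Pre .tm} {M : Term} (h : Irr (app s t)) (hs : InT s (.lam M)) :
    ∃ u, s = .bag (cons (.lam u) nil) ∧ InT u M := by
  cases s with
  | app => simp [InT] at hs
  | bag b =>
    obtain ⟨v, rfl⟩ := h.singleton
    obtain ⟨-, hv, -⟩ := hs
    cases v with
    | var n => cases hv
    | lam u => obtain ⟨N, hN, hu⟩ := hv; cases hN; exact ⟨u, rfl, hu⟩

theorem InT.eq_bag {s : Pre .tm} {V : Term} (hV : V.IsValue) (h : InT s V) :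
    ∃ b, s = .bag b ∧ InT b V := by
  cases s with
  | app => obtain ⟨P, Q, rfl, -⟩ := h; cases hV
  | bag b => exact ⟨b, rfl, h.2⟩

/-- If `e` saw the contracted redex, it would contain a redex itself: its function bags are
singletons by the rule `zero`, so they display the abstraction. The step therefore happens in a part
hidden by empty bags, or inside subexpressions treated by induction. -/
theorem InT.of_step {κ : Kind} {e : Pre κ} (he : Irr e) :
    ∀ {M N : Term}, M.Step N → InT e M → InT e N := by
  induction e with
  | var n => rintro _ N h rfl; cases h
  | lam t ih => rintro _ N h ⟨M, rfl, ht⟩; cases h with | lam h => exact ⟨_, rfl, ih he.lam h ht⟩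
  | nil => exact fun _ _ => trivial
  | cons v b ih ih' => exact fun h h' => ⟨ih he.head h h'.1, ih' he.tail h h'.2⟩
  | bag b ih => exact fun h h' => ⟨h'.1.step h, ih he.bag h h'.2⟩
  | app s t ih ih' =>
    rintro _ N h ⟨P, Q, rfl, hs, ht⟩
    cases h with
    | appL _ h => exact ⟨_, _, rfl, ih he.appL h hs, ht⟩
    | appR _ h => exact ⟨_, _, rfl, hs, ih' he.appR h ht⟩
    | beta M _ hV =>
      obtain ⟨u, rfl, -⟩ := he.fun_lam hs
      obtain ⟨b, rfl, -⟩ := ht.eq_bag hV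
      exact (he _ (.beta _ _)).elim
    | sigma1 M N _ =>
      obtain ⟨P, Q, h, h₁, h₂⟩ : ∃ s₁ s₂, s = .app s₁ s₂ ∧ InT s₁ M.lam ∧ InT s₂ N := by
        cases s with
        | app s₁ s₂ => obtain ⟨P, Q, h, h₁, h₂⟩ := hs; cases h; exact ⟨_, _, rfl, h₁, h₂⟩
        | bag b => exact (Term.not_isValue_app hs.1).elim
      subst h
      obtain ⟨u, rfl, -⟩ := he.appL.fun_lam h₁
      exact (he _ (.sigma1 _ _ _)).elim
    | sigma3 _ M N hV =>
      obtain ⟨P, Q, h, h₁, h₂⟩ : ∃ s₁ s₂, t = .app s₁ s₂ ∧ InT s₁ M.lam ∧ InT s₂ N := by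
        cases t with
        | app s₁ s₂ => obtain ⟨P, Q, h, h₁, h₂⟩ := ht; cases h; exact ⟨_, _, rfl, h₁, h₂⟩
        | bag b => exact (Term.not_isValue_app ht.1).elim
      subst h
      obtain ⟨u, rfl, -⟩ := he.appR.fun_lam h₁
      obtain ⟨b, rfl, -⟩ := hs.eq_bag hV
      obtain ⟨v, rfl⟩ := he.singleton
      exact (he _ (.sigma3 _ _ _)).elim

theorem InT.of_steps {κ : Kind} {e : Pre κ} (he : Irr e) {M N : Term} (h : M.Steps N)
    (hM : InT e M) : InT e N := by
  induction h with
  | refl => exact hM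
  | tail _ h ih => exact ih.of_step he h

/-- The reductions scattered through the definition of `Approx` are gathered into one reduct;
irreducibility keeps what has been established stable under further reduction. -/
theorem Approx.exists_inT {κ : Kind} {e : Pre κ} (he : Irr e) :
    ∀ {M : Term}, Approx e M → ∃ N, M.Steps N ∧ InT e N := by
  induction e with
  | var n => exact fun h => ⟨_, .refl, h⟩
  | lam t ih =>
    rintro _ ⟨M, rfl, h⟩
    obtain ⟨N, h₁, h₂⟩ := ih he.lam h
    exact ⟨_, h₁.lam, _, rfl, h₂⟩
  | app s t ih ih' =>
    rintro M ⟨P, Q, h, hs, ht⟩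
    obtain ⟨P', h₁, h₂⟩ := ih he.appL hs
    obtain ⟨Q', h₁', h₂'⟩ := ih' he.appR ht
    exact ⟨_, h.trans (h₁.app h₁'), _, _, rfl, h₂, h₂'⟩
  | bag b ih =>
    rintro M ⟨V, hV, h, hb⟩
    obtain ⟨W, h₁, h₂⟩ := ih he.bag hb
    exact ⟨W, h.trans h₁, hV.steps h₁, h₂⟩
  | nil => exact fun _ => ⟨_, .refl, trivial⟩
  | cons v b ih ih' =>
    rintro M ⟨hv, hb⟩
    obtain ⟨N₁, h₁, h₁'⟩ := ih he.head hv
    obtain ⟨N₂, h₂, h₂'⟩ := ih' he.tail hb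
    -- The head and the tail of the bag ask for different reducts of the same term; confluence
    -- reconciles them.
    obtain ⟨N, h₃, h₄⟩ := h₁.confluent h₂
    exact ⟨N, h₁.trans h₃, h₁'.of_steps he.head h₃, h₂'.of_steps he.tail h₄⟩

end Pre
-- Expansions of terms with `⊥`, and live expressions.
namespace Pre

open BotTerm (Below Derives Cat)

theorem InTB.mono_bot {κ : Kind} {e : Pre κ} {A : BotTerm} (hA : BotValue A) :
    InTB e .bot → InTB e A := by
  induction e with
  | var n => exact fun h => nomatch h
  | lam t ih => rintro ⟨_, h, -⟩; cases h
  | app s t ih ih' => rintro ⟨_, _, h, -⟩; cases h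
  | bag b ih => exact fun h => ⟨hA, ih h.2⟩
  | nil => exact fun _ => trivial
  | cons v b ih ih' => exact fun h => ⟨ih h.1, ih' h.2⟩

theorem InTB.mono {A B : BotTerm} (h : Below A B) :
    ∀ {κ : Kind} {e : Pre κ}, InTB e A → InTB e B := by
  induction h with
  | bot_var n => exact fun h => h.mono_bot (.var n)
  | bot_lam M => exact fun h => h.mono_bot (.lam M)
  | refl => exact fun h => h
  | trans _ _ ih ih' => exact fun h => ih' (ih h)
  | lam _ ih =>
    intro κ e
    induction e with
    | var n => exact fun h => nomatch h
    | lam t _ => rintro ⟨_, h, h'⟩; cases h; exact ⟨_, rfl, ih h'⟩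
    | app s t _ _ => rintro ⟨_, _, h, -⟩; cases h
    | bag b ih => exact fun h => ⟨.lam _, ih h.2⟩
    | nil => exact fun _ => trivial
    | cons v b ih ih' => exact fun h => ⟨ih h.1, ih' h.2⟩
  | app _ _ ih ih' =>
    intro κ e
    induction e with
    | var n => exact fun h => nomatch h
    | lam t _ => rintro ⟨_, h, -⟩; cases h
    | app s t _ _ => rintro ⟨_, _, h, h₁, h₂⟩; cases h; exact ⟨_, _, rfl, ih h₁, ih' h₂⟩
    | bag b _ => rintro ⟨h, -⟩; cases h
    | nil => exact fun _ => trivial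
    | cons v b ih ih' => exact fun h => ⟨ih h.1, ih' h.2⟩

/-- The number of elements of a bag; by convention, `1` for the expressions that are not bags. -/
def width : {κ : Kind} → Pre κ → ℕ
  | _, bag b => width b
  | _, nil => 0
  | _, cons _ b => width b + 1
  | _, _ => 1

/-- No function part of an application is a bag that is not a singleton. -/
def Alive : {κ : Kind} → Pre κ → Prop
  | _, var _ => True
  | _, lam t => Alive t
  | _, app s t => width s = 1 ∧ Alive s ∧ Alive t
  | _, bag b => Alive b
  | _, nil => True
  | _, cons v b => Alive v ∧ Alive b

theorem Equiv.width_eq {κ : Kind} {e e' : Pre κ} (h : Equiv e e') : width e = width e' := by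
  induction h <;> simp_all [width]

theorem Equiv.alive_iff {κ : Kind} {e e' : Pre κ} (h : Equiv e e') : Alive e ↔ Alive e' := by
  induction h with
  | refl => rfl
  | symm _ ih => exact ih.symm
  | trans _ _ ih ih' => exact ih.trans ih'
  | swap => simp only [Alive]; tauto
  | lam _ ih => simpa only [Alive] using ih
  | app h _ ih ih' => simp only [Alive, h.width_eq, ih, ih']
  | bag _ ih => simpa only [Alive] using ih
  | cons _ _ ih ih' => simp only [Alive, ih, ih']

theorem width_eq_length {b : Pre .bag} : width b = b.toList.length := by
  refine Pre.rec (motive := fun κ e => match κ, e with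
    | .bag, b => width b = b.toList.length
    | .val, _ => True
    | .tm, _ => True) ?_ ?_ ?_ ?_ ?_ ?_ b
  all_goals intros; simp_all [width, toList]

theorem Irr.alive {κ : Kind} {e : Pre κ} (h : Irr e) : Alive e := by
  induction e with
  | var n => trivial
  | lam t ih => exact ih h.lam
  | app s t ih ih' =>
    refine ⟨?_, ih h.appL, ih' h.appR⟩
    cases s with
    | app => rfl
    | bag b => obtain ⟨v, rfl⟩ := h.singleton; rfl
  | bag b ih => exact ih h.bag
  | nil => trivial
  | cons v b ih ih' => exact ⟨ih h.head, ih' h.tail⟩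

theorem Alive.singleton {b : Pre .bag} {t : Pre .tm} (h : Alive (app (.bag b) t)) :
    ∃ v, b = cons v nil :=
  toList_eq_singleton (width_eq_length.symm.trans h.1)

theorem irr_app {s t : Pre .tm} (h : Alive (app s t)) (hs : Irr s) (ht : Irr t)
    (h₁ : ∀ u s', s ≠ app (bag (cons (lam u) nil)) s')
    (h₃ : ∀ v u t', s = bag (cons v nil) → t ≠ app (bag (cons (lam u) nil)) t')
    (hb : ∀ u b, s = bag (cons (lam u) nil) → t ≠ bag b) : Irr (app s t) := by
  intro E h'
  cases h' with
  | beta => exact hb _ _ rfl rfl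
  | zero => exact ‹_ ≠ 1› (width_eq_length.symm.trans h.1)
  | sigma1 => exact h₁ _ _ rfl
  | sigma3 => exact h₃ _ _ _ rfl rfl
  | appL _ h' => exact hs _ h'
  | appR _ h' => exact ht _ h'

theorem InTB.fun_lam {u s : Pre .tm} {A : BotTerm}
    (h : InTB (app (bag (cons (lam u) nil)) s) A) : ∃ M N, A = .app (.lam M) N := by
  obtain ⟨_, N, rfl, ⟨-, ⟨M, rfl, -⟩, -⟩, -⟩ := h
  exact ⟨M, N, rfl⟩

/-! ### The expansions of approximants are irreducible -/

theorem irr_var (n : ℕ) : Irr (var n) := fun _ h => nomatch h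

theorem irr_nil : Irr nil := fun _ h => nomatch h

theorem irr_lam {t : Pre .tm} (h : Irr t) : Irr (lam t) := by
  intro E h'; cases h' with | lam h' => exact h _ h'

theorem irr_bag {b : Pre .bag} (h : Irr b) : Irr (bag b) := by
  intro E h'; cases h' with | bag h' => exact h _ h'

theorem irr_cons {v : Pre .val} {b : Pre .bag} (hv : Irr v) (hb : Irr b) : Irr (cons v b) := by
  intro E h
  cases h with
  | consHead _ h => exact hv _ h
  | consTail _ h => exact hb _ h

/-- The expansions of a value are irreducible as soon as their elements are. -/
theorem irr_of_forall {A : BotTerm} (hA : ∀ v : Pre .val, InTB v A → Alive v → Irr v)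
    {b : Pre .bag} (h : InTB b A) (hb : Alive b) : Irr b := by
  refine Pre.rec (motive := fun κ e => match κ, e with
    | .bag, b => InTB b A → Alive b → Irr b
    | .val, _ => True
    | .tm, _ => True) ?_ ?_ ?_ ?_ ?_ ?_ b h hb
  · exact fun _ => trivial
  · exact fun _ _ => trivial
  · exact fun _ _ _ _ => trivial
  · exact fun _ _ => trivial
  · exact fun _ _ => irr_nil
  · exact fun v b _ ih h h' => irr_cons (hA v h.1 h'.1) (ih h.2 h'.2)

/-- The shape of the root of the terms of a category. -/
def Cat.spec : Cat → BotTerm → Prop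
  | .A, _ => True
  | .B, A => ∀ M N, A ≠ .app (.lam M) N
  | .C, A => ∃ M N, A = .app (.lam M) N
  | .S, A => ∃ M N, A = .app M N ∧ ∀ P, M ≠ .lam P

theorem derives_spec {c : Cat} {A : BotTerm} (h : Derives c A) : Cat.spec c A := by
  induction h with
  | A_of_B | A_of_C => trivial
  | B_of_S _ ih =>
    obtain ⟨M, N, rfl, h⟩ := ih
    intro P Q h'
    cases h'
    exact h _ rfl
  | S_head n _ _ => exact ⟨_, _, rfl, fun _ h => nomatch h⟩
  | S_app h _ ih _ =>
    obtain ⟨M, N, rfl, -⟩ := ih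
    exact ⟨_, _, rfl, fun _ h => nomatch h⟩
  | C_app => exact ⟨_, _, rfl⟩
  | B_var | B_lam | B_bot => exact fun _ _ h => nomatch h

theorem irr_var_expansion {n : ℕ} {s : Pre .tm} (h : InTB s (.var n))
    (ha : Alive s) : Irr s := by
  cases s with
  | app => obtain ⟨_, _, h, -⟩ := h; cases h
  | bag b =>
    refine irr_bag (irr_of_forall (fun v hv _ => ?_) h.2 ha)
    cases v with
    | var n => exact irr_var n
    | lam t => obtain ⟨_, h, -⟩ := hv; cases h

theorem irr_lam_expansion {A : BotTerm} (hA : ∀ {s : Pre .tm}, InTB s A → Alive s → Irr s)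
    {s : Pre .tm} (h : InTB s (.lam A)) (ha : Alive s) : Irr s := by
  cases s with
  | app => obtain ⟨_, _, h, -⟩ := h; cases h
  | bag b =>
    refine irr_bag (irr_of_forall (fun v hv ha => ?_) h.2 ha)
    cases v with
    | var n => cases hv
    | lam t => obtain ⟨_, h, h'⟩ := hv; cases h; exact irr_lam (hA h' ha)

/-- The grammar of approximants rules out the patterns of `β_v`, `σ₁` and `σ₃`, and `Alive` rules
out the rule `zero`. Both hypotheses on `s` are insensitive to the order in bags, so irreducibility
passes to every representative. -/
theorem InTB.irr {c : Cat} {A : BotTerm} (h : Derives c A) :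
    ∀ {s : Pre .tm}, InTB s A → Alive s → Irr s := by
  induction h with
  | A_of_B _ ih => exact ih
  | A_of_C _ ih => exact ih
  | B_of_S _ ih => exact ih
  | B_var n => exact fun h ha => irr_var_expansion h ha
  | B_lam _ ih => exact fun h ha => irr_lam_expansion ih h ha
  | B_bot =>
    intro s h ha
    cases s with
    | app => obtain ⟨_, _, h, -⟩ := h; cases h
    | bag b =>
      refine irr_bag (irr_of_forall (fun v hv ha => ?_) h.2 ha)
      cases v with
      | var n => cases hv
      | lam t => obtain ⟨_, h, h'⟩ := hv; cases h
  | S_head n hM ih =>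
    intro s h ha
    cases s with
    | bag => cases h.1
    | app s t =>
      obtain ⟨_, _, h, hs, ht⟩ := h
      cases h
      refine irr_app ha (irr_var_expansion hs ha.2.1) (ih ht ha.2.2) ?_ ?_ ?_
      · rintro _ _ rfl
        obtain ⟨_, _, h⟩ := hs.fun_lam
        cases h
      · rintro _ _ _ - rfl
        obtain ⟨_, _, rfl⟩ := ht.fun_lam
        exact derives_spec hM _ _ rfl
      · rintro _ _ rfl
        obtain ⟨-, ⟨_, h, -⟩, -⟩ := hs
        cases h
  | S_app hM _ ih ih' =>
    intro s h ha
    cases s with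
    | bag => cases h.1
    | app s t =>
      obtain ⟨_, _, h, hs, ht⟩ := h
      cases h
      obtain ⟨P, Q, rfl, hP⟩ := derives_spec hM
      refine irr_app ha (ih hs ha.2.1) (ih' ht ha.2.2) ?_ ?_ ?_
      · rintro _ _ rfl
        obtain ⟨_, _, h⟩ := hs.fun_lam
        cases h
        exact hP _ rfl
      · rintro _ _ _ rfl
        cases hs.1
      · rintro _ _ rfl
        cases hs.1
  | C_app _ hN ih ih' =>
    intro s h ha
    cases s with
    | bag => cases h.1
    | app s t =>
      obtain ⟨_, _, h, hs, ht⟩ := h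
      cases h
      obtain ⟨P, Q, rfl, hP⟩ := derives_spec hN
      refine irr_app ha (irr_lam_expansion ih hs ha.2.1) (ih' ht ha.2.2) ?_ ?_ ?_
      · rintro _ _ rfl
        obtain ⟨_, _, h⟩ := hs.fun_lam
        cases h
      · rintro _ _ _ - rfl
        obtain ⟨_, _, h⟩ := ht.fun_lam
        cases h
        exact hP _ rfl
      · rintro _ _ - rfl
        cases ht.1

/-! ### The approximant of a term determined by irreducible expansions -/

open Classical in
/-- The least informative approximant of a term whose expansion contains `U`. -/
noncomputable def apx : Term → Set (Pre .tm) → BotTerm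
  | .var n, _ => .var n
  | .lam M, U =>
    if ∃ t, ∃ b, bag b ∈ U ∧ lam t ∈ b.toList then
      .lam (apx M {t | ∃ b, bag b ∈ U ∧ lam t ∈ b.toList})
    else .bot
  | .app M N, U => .app (apx M {s | ∃ t, app s t ∈ U}) (apx N {t | ∃ s, app s t ∈ U})

theorem apx_below (M : Term) : ∀ U, Below (apx M U) M.toBot := by
  induction M with
  | var n => exact fun _ => .refl _
  | lam M ih =>
    intro U
    simp only [apx]
    split_ifs
    · exact .lam (ih _)
    · exact .bot_lam _
  | app M N ih ih' => exact fun U => .app (ih _) (ih' _)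

theorem inTB_bag_iff {b : Pre .bag} {A : BotTerm} : InTB b A ↔ ∀ v ∈ b.toList, InTB v A := by
  refine Pre.rec (motive := fun κ e => match κ, e with
    | .bag, b => InTB b A ↔ ∀ v ∈ b.toList, InTB v A
    | .val, _ => True
    | .tm, _ => True) ?_ ?_ ?_ ?_ ?_ ?_ b
  all_goals intros; simp_all [InTB, toList]

theorem Irr.of_mem {b : Pre .bag} {v : Pre .val} (h : Irr b) (hv : v ∈ b.toList) : Irr v := by
  refine Pre.rec (motive := fun κ e => match κ, e with
    | .bag, b => Irr b → v ∈ b.toList → Irr v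
    | .val, _ => True
    | .tm, _ => True) ?_ ?_ ?_ ?_ ?_ ?_ b h hv
  · exact fun _ => trivial
  · exact fun _ _ => trivial
  · exact fun _ _ _ _ => trivial
  · exact fun _ _ => trivial
  · intro _ h
    simp [toList] at h
  · intro w b _ ih h hv
    simp only [toList, List.mem_cons] at hv
    rcases hv with rfl | hv
    exacts [h.head, ih h.tail hv]

theorem inTB_apx (M : Term) : ∀ {U : Set (Pre .tm)}, (∀ s ∈ U, InT s M) →
    ∀ s ∈ U, InTB s (apx M U) := by
  induction M with
  | var n => exact fun h s hs => inTB_toBot (M := .var n) s |>.2 (h s hs)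
  | lam M ih =>
    intro U h s hs
    obtain ⟨b, rfl, hb⟩ := (h s hs).eq_bag (.lam M)
    rw [inT_bag_iff] at hb
    have key : ∀ v ∈ b.toList, ∃ t, v = lam t ∧ InT t M := by
      intro v hv
      have := hb v hv
      cases v with
      | var n => cases this
      | lam t => obtain ⟨_, h, h'⟩ := this; cases h; exact ⟨t, rfl, h'⟩
    simp only [apx]
    split_ifs with hU
    · refine ⟨.lam _, inTB_bag_iff.2 fun v hv => ?_⟩
      obtain ⟨t, rfl, -⟩ := key v hv
      refine ⟨_, rfl, ih ?_ t ⟨b, hs, hv⟩⟩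
      rintro t ⟨b, hb, ht⟩
      obtain ⟨_, h, h'⟩ := inT_bag_iff.1 (h _ hb).2 _ ht
      cases h
      exact h'
    · refine ⟨.bot, inTB_bag_iff.2 fun v hv => ?_⟩
      obtain ⟨t, rfl, -⟩ := key v hv
      exact (hU ⟨t, b, hs, hv⟩).elim
  | app M N ih ih' =>
    intro U h s hs
    have key : ∀ s t, app s t ∈ U → InT s M ∧ InT t N := by
      intro s t hst
      obtain ⟨_, _, h, h'⟩ := h _ hst
      cases h
      exact h'
    cases s with
    | bag b => exact (Term.not_isValue_app (h _ hs).1).elim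
    | app s t =>
      exact ⟨_, _, rfl, ih (by rintro s ⟨t, h⟩; exact (key s t h).1) s ⟨t, hs⟩,
        ih' (by rintro t ⟨s, h⟩; exact (key s t h).2) t ⟨s, hs⟩⟩

/-- The category of the approximants of a term. -/
def catOf : Term → Cat
  | .app (.lam _) _ => .C
  | .app _ _ => .S
  | _ => .B

theorem derives_of_catOf {M : Term} {A : BotTerm} (h : Derives (catOf M) A) : Derives .A A := by
  unfold catOf at h
  split at h
  exacts [.A_of_C h, .A_of_B (.B_of_S h), .A_of_B h]

theorem exists_app {s : Pre .tm} {M N : Term} (h : InT s (.app M N)) :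
    ∃ s₁ s₂, s = app s₁ s₂ ∧ InT s₁ M ∧ InT s₂ N := by
  cases s with
  | bag b => exact (Term.not_isValue_app h.1).elim
  | app s t => obtain ⟨_, _, h, h'⟩ := h; cases h; exact ⟨s, t, rfl, h'⟩

/-- Every position that `apx` keeps is seen by some element of `U`, so a redex of `M` left there
would show up in an irreducible expression. Nonemptiness supplies such a witness and is inherited by
the sets used in the recursive calls. -/
theorem derives_apx (M : Term) : ∀ {U : Set (Pre .tm)}, U.Nonempty →
    (∀ s ∈ U, InT s M ∧ Irr s) → Derives (catOf M) (apx M U) := by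
  induction M with
  | var n => exact fun _ _ => .B_var n
  | lam M ih =>
    intro U _ h
    simp only [apx]
    split_ifs with hU
    · refine .B_lam (derives_of_catOf (ih hU ?_))
      rintro t ⟨b, hb, ht⟩
      obtain ⟨_, h', h''⟩ := inT_bag_iff.1 (h _ hb).1.2 _ ht
      cases h'
      exact ⟨h'', ((h _ hb).2.bag.of_mem ht).lam⟩
    · exact .B_bot
  | app M N ih ih' =>
    intro U hU h
    have key : ∀ s t, app s t ∈ U → (InT s M ∧ Irr s) ∧ InT t N ∧ Irr t := by
      intro s t hst
      obtain ⟨⟨_, _, h, h₁, h₂⟩, hi⟩ := h _ hst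
      cases h
      exact ⟨⟨h₁, hi.appL⟩, h₂, hi.appR⟩
    obtain ⟨s, hs⟩ := hU
    obtain ⟨s, t, rfl, hsM, htN⟩ := exists_app (h _ hs).1
    have hst := (h _ hs).2
    have dM := ih (U := {s | ∃ t, app s t ∈ U}) ⟨s, t, hs⟩ (by rintro s ⟨t, h⟩; exact (key s t h).1)
    have dN := ih' (U := {t | ∃ s, app s t ∈ U}) ⟨t, s, hs⟩ (by rintro t ⟨s, h⟩; exact (key s t h).2)
    -- A value applied to a redex-shaped argument would make the chosen element of `U` a `σ₃`-redex.
    have not_C (hM : M.IsValue) : ∀ P Q, N ≠ .app (.lam P) Q := by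
      rintro P Q rfl
      obtain ⟨b, rfl, -⟩ := hsM.eq_bag hM
      obtain ⟨v, rfl⟩ := hst.singleton
      obtain ⟨t₁, t₂, rfl, ht, -⟩ := exists_app htN
      obtain ⟨u, rfl, -⟩ := hst.appR.fun_lam ht
      exact hst _ (.sigma3 _ _ _)
    cases M with
    | var n =>
      refine .S_head n ?_
      cases N with
      | var | lam => exact dN
      | app N₁ N₂ =>
        cases N₁ with
        | var | app => exact .B_of_S dN
        | lam => exact (not_C (.var n) _ _ rfl).elim
    | lam M =>
      obtain ⟨u, rfl, hu⟩ := hst.fun_lam hsM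
      have not_value : ¬ N.IsValue := by
        intro hN
        obtain ⟨b, rfl, -⟩ := htN.eq_bag hN
        exact hst _ (.beta _ _)
      -- The function bag is a singleton, so the abstraction is really seen and is not pruned to
      -- `⊥`, which the grammar does not allow as a head.
      have hex : ∃ u, ∃ b, bag b ∈ {s | ∃ t, app s t ∈ U} ∧ lam u ∈ b.toList :=
        ⟨u, _, ⟨t, hs⟩, by simp [toList]⟩
      simp only [apx, if_pos hex] at dM ⊢
      refine .C_app ?_ ?_
      · cases dM with
        | B_lam h => exact h
        | B_of_S h => cases h
      cases N with
      | var => exact (not_value (.var _)).elim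
      | lam => exact (not_value (.lam _)).elim
      | app N₁ N₂ =>
        cases N₁ with
        | var | app => exact dN
        | lam => exact (not_C (.lam _) _ _ rfl).elim
    | app M₁ M₂ =>
      cases M₁ with
      | var | app => exact .S_app dM (derives_of_catOf dN)
      | lam M₁ =>
        obtain ⟨s₁, s₂, rfl, hs₁, -⟩ := exists_app hsM
        obtain ⟨u, rfl, -⟩ := hst.appL.fun_lam hs₁
        exact (hst _ (.sigma1 _ _ _)).elim

/-! ### Approximants are determined by their expansions -/

/-- The expansion of a term with `⊥` into bags with at most one element. -/
def full : BotTerm → Pre .tm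
  | .bot => bag nil
  | .var n => bag (cons (var n) nil)
  | .lam A => bag (cons (lam (full A)) nil)
  | .app A B => app (full A) (full B)

theorem inTB_full : ∀ A : BotTerm, InTB (full A) A
  | .bot => ⟨.bot, trivial⟩
  | .var n => ⟨.var n, rfl, trivial⟩
  | .lam A => ⟨.lam A, ⟨A, rfl, inTB_full A⟩, trivial⟩
  | .app A B => ⟨A, B, rfl, inTB_full A, inTB_full B⟩

/-- The one-element bags of `full A` display each constructor of `A`, and its empty bags only
require a term that expands to a bag, which is exactly what `⊥` lies below. -/
theorem below_of_full (A : BotTerm) : ∀ {B : BotTerm}, InTB (full A) B → Below A B := by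
  induction A with
  | bot =>
    rintro B ⟨h, -⟩
    cases h with
    | bot => exact .refl _
    | var n => exact .bot_var n
    | lam A => exact .bot_lam A
  | var n => rintro B ⟨-, h, -⟩; cases h; exact .refl _
  | lam A ih => rintro B ⟨-, ⟨C, rfl, h⟩, -⟩; exact .lam (ih h)
  | app A A' ih ih' => rintro B ⟨C, C', rfl, h, h'⟩; exact .app (ih h) (ih' h')

theorem alive_full {c : Cat} {A : BotTerm} (h : Derives c A) : Alive (full A) := by
  induction h with
  | A_of_B _ ih | A_of_C _ ih | B_of_S _ ih => exact ih
  | B_var | B_bot => simp [full, Alive]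
  | B_lam _ ih => simpa [full, Alive] using ih
  | C_app _ _ ih ih' => simpa [full, Alive, width] using ⟨ih, ih'⟩
  | S_head _ _ ih => simpa [full, Alive, width] using ih
  | S_app h _ ih ih' =>
    obtain ⟨_, _, rfl, -⟩ := derives_spec h
    exact ⟨rfl, ih, ih'⟩

theorem irr_full {c : Cat} {A : BotTerm} (h : Derives c A) : Irr (full A) :=
  (inTB_full A).irr h (alive_full h)

end Pre

/-! ### Approximants of a term form a directed, downward closed family. -/

section

open Pre BotTerm

theorem exists_approxOf {M N : Term} (h : M.Steps N) {U : Set (Pre .tm)} (hne : U.Nonempty)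
    (hU : ∀ s ∈ U, InT s N ∧ Irr s) : ∃ A ∈ approxOf M, ∀ s ∈ U, InTB s A :=
  ⟨apx N U, ⟨derives_of_catOf (derives_apx N hne hU), N, h, apx_below N U⟩,
    inTB_apx N fun s hs => (hU s hs).1⟩

theorem mem_approxOf_of_below {M : Term} {A B : BotTerm} (hA : A ∈ approximants)
    (h : Below A B) (hB : B ∈ approxOf M) : A ∈ approxOf M := by
  obtain ⟨-, N, hN, h'⟩ := hB
  exact ⟨hA, N, hN, h.trans h'⟩

/-- After passing to a common reduct, the upper bound is the part of it seen by `full A` and `full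
B` together. -/
theorem directed_approxOf {M : Term} {A B : BotTerm} (hA : A ∈ approxOf M) (hB : B ∈ approxOf M) :
    ∃ C ∈ approxOf M, Below A C ∧ Below B C := by
  obtain ⟨hA, N₁, h₁, hA₁⟩ := hA
  obtain ⟨hB, N₂, h₂, hB₂⟩ := hB
  obtain ⟨N, h₃, h₄⟩ := h₁.confluent h₂
  have fA := ((inTB_toBot _).1 ((inTB_full A).mono hA₁)).of_steps (irr_full hA) h₃
  have fB := ((inTB_toBot _).1 ((inTB_full B).mono hB₂)).of_steps (irr_full hB) h₄
  obtain ⟨C, hC, hU⟩ := exists_approxOf (h₁.trans h₃) (U := {full A, full B}) ⟨_, .inl rfl⟩ (by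
    rintro _ (rfl | rfl)
    exacts [⟨fA, irr_full hA⟩, ⟨fB, irr_full hB⟩])
  exact ⟨C, hC, below_of_full A (hU _ (.inl rfl)), below_of_full B (hU _ (.inr rfl))⟩

end

namespace Pre

/-! ### Reduction of single expressions -/

/-- `e'` is an element of a set to which `e` reduces in one step. -/
def Red {κ : Kind} (e e' : Pre κ) : Prop := ∃ E, Step e E ∧ e' ∈ E

/-- The reflexive transitive closure of `Red`. -/
abbrev Reds {κ : Kind} : Pre κ → Pre κ → Prop := Relation.ReflTransGen Red

theorem Reds.lam {t t' : Pre .tm} (h : Reds t t') : Reds (lam t) (lam t') :=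
  Relation.ReflTransGen.lift Pre.lam (fun _ _ ⟨_, h, h'⟩ => ⟨_, .lam h, _, h', rfl⟩) _ _ h

theorem Reds.bag {b b' : Pre .bag} (h : Reds b b') : Reds (bag b) (bag b') :=
  Relation.ReflTransGen.lift Pre.bag (fun _ _ ⟨_, h, h'⟩ => ⟨_, .bag h, _, h', rfl⟩) _ _ h

theorem Reds.app {s s' t t' : Pre .tm} (h : Reds s s') (h' : Reds t t') :
    Reds (app s t) (app s' t') :=
  (Relation.ReflTransGen.lift (fun s => Pre.app s t)
      (fun _ _ ⟨_, h, h'⟩ => ⟨_, .appL t h, _, h', rfl⟩) _ _ h).trans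
    (Relation.ReflTransGen.lift (Pre.app s')
      (fun _ _ ⟨_, h, h'⟩ => ⟨_, .appR s' h, _, h', rfl⟩) _ _ h')

theorem Reds.cons {v v' : Pre .val} {b b' : Pre .bag} (h : Reds v v') (h' : Reds b b') :
    Reds (cons v b) (cons v' b') :=
  (Relation.ReflTransGen.lift (fun v => Pre.cons v b)
      (fun _ _ ⟨_, h, h'⟩ => ⟨_, .consHead b h, _, h', rfl⟩) _ _ h).trans
    (Relation.ReflTransGen.lift (Pre.cons v')
      (fun _ _ ⟨_, h, h'⟩ => ⟨_, .consTail v' h, _, h', rfl⟩) _ _ h')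

/-! ### Expressions that reduce to an alive expression are alive -/

theorem width_shift {κ : Kind} (e : Pre κ) : ∀ c, width (shift c e) = width e := by
  induction e with
  | var n => intro c; simp only [shift]; split_ifs <;> rfl
  | bag b ih => exact ih
  | cons v b _ ih => intro c; simp only [shift, width, ih]
  | _ => exact fun _ => rfl

theorem alive_shift {κ : Kind} {e : Pre κ} : ∀ {c}, Alive (shift c e) ↔ Alive e := by
  induction e with
  | var n => intro c; simp only [shift]; split_ifs <;> rfl
  | lam t ih => exact ih
  | app s t ih ih' => intro c; simp only [shift, Alive, ih, ih', width_shift]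
  | bag b ih => exact ih
  | nil => exact .rfl
  | cons v b ih ih' => intro c; simp only [shift, Alive, ih, ih']

theorem width_plug_bag (b : Pre .bag) (k : ℕ) (vs : List (Pre .val)) :
    width (plug k b vs) = width b := by
  refine Pre.rec (motive := fun κ e => match κ, e with
    | .bag, b => ∀ vs, width (plug k b vs) = width b
    | .val, _ => True
    | .tm, _ => True) ?_ ?_ ?_ ?_ ?_ ?_ b vs
  all_goals intros; simp_all [width, plug]

theorem width_plug (s : Pre .tm) (k : ℕ) (vs : List (Pre .val)) :
    width (plug k s vs) = width s := by
  cases s with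
  | app => rfl
  | bag b => exact width_plug_bag b k vs

/-- Linearity is what makes this work: the list has as many elements as there are occurrences, so
none is discarded and each can be inspected in the result. -/
theorem Alive.of_plug {κ : Kind} {e : Pre κ} : ∀ {k : ℕ} {vs : List (Pre .val)},
    deg k e = vs.length → Alive (plug k e vs) → Alive e ∧ ∀ v ∈ vs, Alive v := by
  have split {P : Pre .val → Prop} (vs : List (Pre .val)) (n : ℕ) (h : ∀ v ∈ vs.take n, P v)
      (h' : ∀ v ∈ vs.drop n, P v) : ∀ v ∈ vs, P v := by
    intro v hv
    rw [← List.take_append_drop n vs, List.mem_append] at hv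
    exact hv.elim (h v) (h' v)
  induction e with
  | var n =>
    intro k vs hd h
    refine ⟨trivial, fun v hv => ?_⟩
    simp only [deg] at hd
    simp only [plug] at h
    split_ifs at hd h
    · obtain ⟨w, rfl⟩ := List.length_eq_one_iff.1 hd.symm
      simp only [List.mem_singleton] at hv
      subst hv
      exact h
    all_goals simp [List.length_eq_zero_iff.1 hd.symm] at hv
  | lam t ih =>
    intro k vs hd h
    obtain ⟨h₁, h₂⟩ := ih (by simpa [deg] using hd) h
    exact ⟨h₁, fun v hv => alive_shift.1 (h₂ _ (List.mem_map_of_mem hv))⟩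
  | app s t ih ih' =>
    rintro k vs hd ⟨hw, hs, ht⟩
    simp only [deg] at hd
    obtain ⟨h₁, h₂⟩ := ih (by simp; omega) hs
    obtain ⟨h₃, h₄⟩ := ih' (by simp; omega) ht
    exact ⟨⟨by rwa [width_plug] at hw, h₁, h₃⟩, split _ _ h₂ h₄⟩
  | bag b ih => exact ih
  | nil =>
    intro k vs hd _
    rw [List.length_eq_zero_iff.1 hd.symm]
    exact ⟨trivial, by simp⟩
  | cons v b ih ih' =>
    rintro k vs hd ⟨hs, ht⟩
    simp only [deg] at hd
    obtain ⟨h₁, h₂⟩ := ih (by simp; omega) hs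
    obtain ⟨h₃, h₄⟩ := ih' (by simp; omega) ht
    exact ⟨⟨h₁, h₃⟩, split _ _ h₂ h₄⟩

theorem alive_bag_iff {b : Pre .bag} : Alive b ↔ ∀ v ∈ b.toList, Alive v := by
  refine Pre.rec (motive := fun κ e => match κ, e with
    | .bag, b => Alive b ↔ ∀ v ∈ b.toList, Alive v
    | .val, _ => True
    | .tm, _ => True) ?_ ?_ ?_ ?_ ?_ ?_ b
  all_goals intros; simp_all [Alive, toList]

/-- Reduction does not change the width of a bag. -/
theorem Step.width_eq {b : Pre .bag} {E : Set (Pre .bag)} (h : Step b E) :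
    ∀ e ∈ E, width e = width b := by
  refine Step.rec (motive := fun {κ} e E _ => match κ, e, E with
    | .bag, b, E => ∀ e ∈ E, width e = width b
    | .val, _, _ => True
    | .tm, _, _ => True) ?_ ?_ ?_ ?_ ?_ ?_ ?_ ?_ ?_ ?_ h
  all_goals intros; simp_all [width]

/-- No rule with a nonempty result erases a subexpression, and widths of bags are unchanged by
reduction and by substitution, so a bad function bag would persist. -/
theorem Alive.of_step {κ : Kind} {e : Pre κ} {E : Set (Pre κ)} (h : Step e E) :
    ∀ e' ∈ E, Alive e' → Alive e := by
  induction h with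
  | beta t b =>
    rintro _ ⟨hd, ws, hws, rfl⟩ h
    obtain ⟨h₁, h₂⟩ := h.of_plug (hd.trans hws.length_eq.symm)
    exact ⟨rfl, ⟨h₁, trivial⟩, alive_bag_iff.2 fun v hv => h₂ v (hws.mem_iff.2 hv)⟩
  | zero => exact fun _ h => h.elim
  | sigma1 t s₁ s₂ =>
    rintro _ rfl ⟨-, ⟨⟨h₀, h₁, h₂⟩, -⟩, h₃⟩
    exact ⟨rfl, ⟨rfl, ⟨h₁, trivial⟩, h₃⟩, alive_shift.1 h₂⟩
  | sigma3 v t s =>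
    rintro _ rfl ⟨-, ⟨⟨-, ⟨h₁, -⟩, h₂⟩, -⟩, h₃⟩
    exact ⟨rfl, ⟨alive_shift.1 h₁, trivial⟩, rfl, ⟨h₂, trivial⟩, h₃⟩
  | lam _ ih => rintro _ ⟨t, ht, rfl⟩ h; exact ih t ht h
  | @appL s S t h ih =>
    rintro _ ⟨s', hs', rfl⟩ ⟨hw, h₁, h₂⟩
    refine ⟨?_, ih _ hs' h₁, h₂⟩
    cases s with
    | app => rfl
    | bag b =>
      cases h with
      | bag h =>
        obtain ⟨b', hb', rfl⟩ := hs'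
        exact (h.width_eq b' hb').symm.trans hw
  | appR s _ ih => rintro _ ⟨t', ht', rfl⟩ ⟨hw, h₁, h₂⟩; exact ⟨hw, h₁, ih _ ht' h₂⟩
  | bag _ ih => rintro _ ⟨t, ht, rfl⟩ h; exact ih t ht h
  | consHead _ _ ih => rintro _ ⟨t, ht, rfl⟩ h; exact ⟨ih t ht h.1, h.2⟩
  | consTail _ _ ih => rintro _ ⟨t, ht, rfl⟩ h; exact ⟨h.1, ih t ht h.2⟩

theorem Alive.of_reds {κ : Kind} {e e' : Pre κ} (h : Reds e e') (h' : Alive e') : Alive e := by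
  induction h with
  | refl => exact h'
  | tail _ h ih => obtain ⟨E, hE, he⟩ := h; exact ih (.of_step hE _ he h')

/-! ### Simulation -/

theorem InT.exists_shift {κ : Kind} {e : Pre κ} : ∀ {c : ℕ} {M : Term}, InT e (M.shift c) →
    ∃ e', e = shift c e' ∧ InT e' M := by
  induction e with
  | var n =>
    intro c M h
    cases M with
    | var m =>
      refine ⟨.var m, ?_, rfl⟩
      simp only [Term.shift, shift, InT] at h ⊢
      split_ifs at h ⊢ <;> simp_all
    | lam | app => cases h
  | lam t ih =>
    rintro c M ⟨N, h, ht⟩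
    cases M with
    | var m => simp only [Term.shift] at h; split_ifs at h
    | lam M => cases h; obtain ⟨t, rfl, h⟩ := ih ht; exact ⟨lam t, rfl, _, rfl, h⟩
    | app => cases h
  | app s t ih ih' =>
    rintro c M ⟨P, Q, h, hs, ht⟩
    cases M with
    | var m => simp only [Term.shift] at h; split_ifs at h
    | lam => cases h
    | app M N =>
      cases h
      obtain ⟨s, rfl, h⟩ := ih hs
      obtain ⟨t, rfl, h'⟩ := ih' ht
      exact ⟨app s t, rfl, _, _, rfl, h, h'⟩
  | bag b ih =>
    rintro c M ⟨hM, hb⟩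
    obtain ⟨b, rfl, h⟩ := ih hb
    refine ⟨bag b, rfl, ?_, h⟩
    cases M with
    | var | lam => constructor
    | app => cases hM
  | nil => exact fun _ => ⟨nil, rfl, trivial⟩
  | cons v b ih ih' =>
    rintro c M ⟨hv, hb⟩
    obtain ⟨v, rfl, h⟩ := ih hv
    obtain ⟨b, rfl, h'⟩ := ih' hb
    exact ⟨cons v b, rfl, h, h'⟩

/-- The resource values lying over the copies of `V` are cut out, from left to right, and replaced
by the variable. Since `V` is a value, the expansion over each copy is a bag, just as over the
variable itself. -/
theorem InT.exists_plug {κ : Kind} {e : Pre κ} : ∀ {k : ℕ} {V M : Term}, V.IsValue →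
    InT e (Term.subst k V M) → ∃ (p : Pre κ) (vs : List (Pre .val)), InT p M ∧
      (∀ v ∈ vs, InT v V) ∧ deg k p = vs.length ∧ e = plug k p vs := by
  induction e with
  | var n =>
    intro k V M hV h
    cases M with
    | var m =>
      by_cases hm : m = k
      · subst hm
        simp only [Term.subst, if_true] at h
        exact ⟨.var m, [.var n], rfl, by simpa using h, by simp [deg], by simp [plug]⟩
      · refine ⟨.var m, [], rfl, by simp, by simp [deg, hm], ?_⟩
        simp only [Term.subst, hm, if_false, plug, InT] at h ⊢
        split_ifs at h ⊢ <;> simp_all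
    | lam | app => cases h
  | lam t ih =>
    rintro k V M hV ⟨N, h, ht⟩
    cases M with
    | var m =>
      by_cases hm : m = k
      · subst hm
        simp only [Term.subst, if_true] at h
        exact ⟨.var m, [.lam t], rfl, by simpa using ⟨N, h, ht⟩, by simp [deg], by simp [plug]⟩
      · simp only [Term.subst, hm, if_false] at h
        split_ifs at h
    | lam M =>
      cases h
      obtain ⟨p, vs, hp, hvs, hd, rfl⟩ := ih (hV.shift 0) ht
      have hws : ∃ ws : List (Pre .val), vs = ws.map (shift 0) ∧ ∀ w ∈ ws, InT w V := by
        clear hd ht ih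
        induction vs with
        | nil => exact ⟨[], rfl, by simp⟩
        | cons v vs ih =>
          obtain ⟨ws, rfl, h⟩ := ih fun v hv => hvs v (.tail _ hv)
          obtain ⟨w, rfl, hw⟩ := (hvs v (.head _)).exists_shift
          exact ⟨w :: ws, rfl, by simpa using ⟨hw, h⟩⟩
      obtain ⟨ws, rfl, hws⟩ := hws
      exact ⟨lam p, ws, ⟨_, rfl, hp⟩, hws, by simpa [deg] using hd, rfl⟩
    | app => cases h
  | app s t ih ih' =>
    rintro k V M hV ⟨P, Q, h, hs, ht⟩
    cases M with
    | var m =>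
      have := (Term.IsValue.var m).subst hV k
      rw [h] at this
      cases this
    | lam => cases h
    | app M N =>
      cases h
      obtain ⟨p, vs, hp, hvs, hd, rfl⟩ := ih hV hs
      obtain ⟨q, ws, hq, hws, hd', rfl⟩ := ih' hV ht
      exact ⟨app p q, vs ++ ws, ⟨_, _, rfl, hp, hq⟩,
        fun v hv => (List.mem_append.1 hv).elim (hvs v) (hws v), by simp [deg, hd, hd'],
        by simp [plug, hd]⟩
  | bag b ih =>
    rintro k V M hV ⟨hM, hb⟩
    obtain ⟨p, vs, hp, hvs, hd, rfl⟩ := ih hV hb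
    refine ⟨bag p, vs, ⟨?_, hp⟩, hvs, hd, rfl⟩
    cases M with
    | var | lam => constructor
    | app => cases hM
  | nil => exact fun _ _ => ⟨nil, [], trivial, by simp, rfl, rfl⟩
  | cons v b ih ih' =>
    rintro k V M hV ⟨hs, ht⟩
    obtain ⟨p, vs, hp, hvs, hd, rfl⟩ := ih hV hs
    obtain ⟨q, ws, hq, hws, hd', rfl⟩ := ih' hV ht
    exact ⟨cons p q, vs ++ ws, ⟨hp, hq⟩,
      fun v hv => (List.mem_append.1 hv).elim (hvs v) (hws v), by simp [deg, hd, hd'],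
      by simp [plug, hd]⟩

/-- The bag of the elements of a list. -/
def ofList : List (Pre .val) → Pre .bag
  | [] => nil
  | v :: vs => cons v (ofList vs)

@[simp] theorem toList_ofList : ∀ vs : List (Pre .val), (ofList vs).toList = vs
  | [] => by simp [ofList, toList]
  | v :: vs => by simp [ofList, toList, toList_ofList vs]

/-- The function part of an application, if it is an alive expansion of an abstraction. -/
theorem Alive.fun_lam {s t : Pre .tm} {M : Term} (h : Alive (app s t)) (hs : InT s (.lam M)) :
    ∃ u, s = .bag (cons (lam u) nil) ∧ InT u M := by
  obtain ⟨b, rfl, hb⟩ := hs.eq_bag (.lam M)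
  obtain ⟨v, rfl⟩ := h.singleton
  obtain ⟨hv, -⟩ := hb
  cases v with
  | var n => cases hv
  | lam u => obtain ⟨N, hN, hu⟩ := hv; cases hN; exact ⟨u, rfl, hu⟩

theorem InT.lam_bag {t : Pre .tm} {M : Term} (h : InT t M) :
    InT (bag (cons (lam t) nil)) M.lam :=
  ⟨.lam _, ⟨_, rfl, h⟩, trivial⟩

/-- The rules are read backwards. For `σ₁` and `σ₃` this requires the function bags to be
singletons, hence the hypothesis `Alive`; for `β_v` the decomposition of `InT.exists_plug` is
enough. -/
theorem InT.exists_reds {M N : Term} (h : M.Step N) : ∀ {t : Pre .tm}, InT t N → Alive t →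
    ∃ s, InT s M ∧ Reds s t := by
  induction h with
  | beta M V hV =>
    intro t ht _
    obtain ⟨p, vs, hp, hvs, hd, rfl⟩ := ht.exists_plug hV
    exact ⟨app (bag (cons (lam p) nil)) (bag (ofList vs)),
      ⟨_, _, rfl, hp.lam_bag, hV, inT_bag_iff.2 (by simpa using hvs)⟩,
      .single ⟨_, .beta _ _, by simpa using hd, vs, by simp, rfl⟩⟩
  | sigma1 M N P =>
    intro t ht ha
    obtain ⟨s, q, rfl, hs, hq⟩ := exists_app ht
    obtain ⟨u, rfl, hu⟩ := ha.fun_lam hs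
    obtain ⟨m, p, rfl, hm, hp⟩ := exists_app hu
    obtain ⟨p, rfl, hp'⟩ := hp.exists_shift
    exact ⟨app (app (bag (cons (lam m) nil)) q) p, ⟨_, _, rfl, ⟨_, _, rfl, hm.lam_bag, hq⟩, hp'⟩,
      .single ⟨_, .sigma1 _ _ _, rfl⟩⟩
  | sigma3 V M N hV =>
    intro t ht ha
    obtain ⟨s, q, rfl, hs, hq⟩ := exists_app ht
    obtain ⟨u, rfl, hu⟩ := ha.fun_lam hs
    obtain ⟨w, m, rfl, hw, hm⟩ := exists_app hu
    obtain ⟨b, rfl, hb⟩ := hw.eq_bag (hV.shift 0)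
    obtain ⟨v, rfl⟩ := Alive.singleton ha.2.1.1
    obtain ⟨v, rfl, hv⟩ := hb.1.exists_shift
    exact ⟨app (bag (cons v nil)) (app (bag (cons (lam m) nil)) q),
      ⟨_, _, rfl, ⟨hV, hv, trivial⟩, _, _, rfl, hm.lam_bag, hq⟩,
      .single ⟨_, .sigma3 _ _ _, rfl⟩⟩
  | @lam M M' _ ih =>
    intro t ht ha
    obtain ⟨b, rfl, hb⟩ := ht.eq_bag (.lam _)
    -- The elements of the bag are unrelated expansions of the body, so each is lifted separately
    -- and the reductions are run one after the other.
    suffices ∃ b', InT b' M.lam ∧ Reds b' b by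
      obtain ⟨b', h, h'⟩ := this
      exact ⟨bag b', ⟨.lam _, h⟩, h'.bag⟩
    refine Pre.rec (motive := fun κ e => match κ, e with
      | .bag, b => InT b M'.lam → Alive b → ∃ b', InT b' M.lam ∧ Reds b' b
      | .val, _ => True
      | .tm, _ => True) ?_ ?_ ?_ ?_ ?_ ?_ b hb ha
    · exact fun _ => trivial
    · exact fun _ _ => trivial
    · exact fun _ _ _ _ => trivial
    · exact fun _ _ => trivial
    · exact fun _ _ => ⟨nil, trivial, .refl⟩
    · rintro v b - ih' ⟨hv, hb⟩ ⟨hav, hab⟩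
      obtain ⟨b', h₁, h₂⟩ := ih' hb hab
      cases v with
      | var n => cases hv
      | lam t =>
        obtain ⟨_, h, ht⟩ := hv
        cases h
        obtain ⟨s, h₃, h₄⟩ := ih ht hav
        exact ⟨cons (lam s) b', ⟨⟨_, rfl, h₃⟩, h₁⟩, h₄.lam.cons h₂⟩
  | appL N _ ih =>
    intro t ht ha
    obtain ⟨s, q, rfl, hs, hq⟩ := exists_app ht
    obtain ⟨s', h, h'⟩ := ih hs ha.2.1
    exact ⟨app s' q, ⟨_, _, rfl, h, hq⟩, h'.app .refl⟩
  | appR M _ ih =>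
    intro t ht ha
    obtain ⟨s, q, rfl, hs, hq⟩ := exists_app ht
    obtain ⟨s', h, h'⟩ := ih hq ha.2.2
    exact ⟨app s s', ⟨_, _, rfl, hs, h⟩, .app .refl h'⟩

theorem InT.exists_reds_of_steps {M N : Term} (h : M.Steps N) {t : Pre .tm} (ht : InT t N)
    (ha : Alive t) : ∃ s, InT s M ∧ Reds s t := by
  induction h using Relation.ReflTransGen.head_induction_on with
  | refl => exact ⟨t, ht, .refl⟩
  | head h _ ih =>
    obtain ⟨s, hs, hst⟩ := ih
    obtain ⟨s', hs', h'⟩ := hs.exists_reds h (.of_reds hst ha)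
    exact ⟨s', hs', h'.trans hst⟩

/-! ### Termination -/

/-- A measure that decreases along the reduction. -/
def weight : {κ : Kind} → Pre κ → ℕ
  | _, var _ => 1
  | _, lam t => weight t + 1
  | _, app s t => weight s * weight t
  | _, bag b => 2 * weight b
  | _, nil => 1
  | _, cons v b => weight v * weight b

theorem weight_pos {κ : Kind} (e : Pre κ) : 0 < weight e := by
  induction e <;> simp_all [weight]

theorem two_le_weight : ∀ t : Pre .tm, 2 ≤ weight t
  | app s t => by
    have := Nat.mul_le_mul (two_le_weight s) (two_le_weight t)
    simp only [weight]; omega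
  | bag b => by have := weight_pos b; simp only [weight]; omega

theorem Equiv.weight_eq {κ : Kind} {e e' : Pre κ} (h : Equiv e e') : weight e = weight e' := by
  induction h with
  | swap v w b => simp only [weight]; ring
  | _ => simp_all [weight]

@[simp] theorem weight_shift {κ : Kind} (e : Pre κ) : ∀ c, weight (shift c e) = weight e := by
  induction e with
  | var n => intro c; simp only [shift]; split_ifs <;> rfl
  | _ => intro c; simp_all [shift, weight]

theorem weight_toList (b : Pre .bag) : weight b = (b.toList.map weight).prod := by
  refine Pre.rec (motive := fun κ e => match κ, e with
    | .bag, b => weight b = (b.toList.map weight).prod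
    | .val, _ => True
    | .tm, _ => True) ?_ ?_ ?_ ?_ ?_ ?_ b
  all_goals intros; simp_all [weight, toList]

theorem prod_weight_pos (vs : List (Pre .val)) : 0 < (vs.map weight).prod :=
  List.prod_pos fun _ h => by obtain ⟨v, -, rfl⟩ := List.mem_map.1 h; exact weight_pos v

/-- Weights multiply and a variable weighs `1`, so each replacement contributes a factor. The
successor at an abstraction is what makes this only an inequality. -/
theorem weight_plug_le {κ : Kind} (e : Pre κ) : ∀ (k : ℕ) (vs : List (Pre .val)),
    weight (plug k e vs) ≤ weight e * (vs.map weight).prod := by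
  have split (vs : List (Pre .val)) (n : ℕ) : (vs.map weight).prod =
      ((vs.take n).map weight).prod * ((vs.drop n).map weight).prod := by
    rw [← List.prod_append, ← List.map_append, List.take_append_drop]
  induction e with
  | var n =>
    intro k vs
    have hvs := prod_weight_pos vs
    simp only [plug]
    split_ifs
    · cases vs with
      | nil => simp [weight]
      | cons v vs => simpa [weight] using Nat.le_mul_of_pos_right _ (prod_weight_pos vs)
    · simpa only [weight, one_mul] using Nat.succ_le_of_lt hvs
    · simpa only [weight, one_mul] using Nat.succ_le_of_lt hvs
  | lam t ih =>
    intro k vs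
    have := ih (k + 1) (vs.map (shift 0))
    have hvs := prod_weight_pos vs
    have hm : ((vs.map (shift 0)).map weight) = vs.map weight := by simp
    rw [hm] at this
    simp only [plug, weight, Nat.add_mul]
    omega
  | app s t ih ih' =>
    intro k vs
    simp only [plug, weight]
    rw [split vs (deg k s), Nat.mul_mul_mul_comm]
    exact Nat.mul_le_mul (ih _ _) (ih' _ _)
  | bag b ih =>
    intro k vs
    simp only [plug, weight, Nat.mul_assoc]
    exact Nat.mul_le_mul_left _ (ih _ _)
  | nil =>
    intro k vs
    simpa only [plug, weight, one_mul] using Nat.succ_le_of_lt (prod_weight_pos vs)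
  | cons v b ih ih' =>
    intro k vs
    simp only [plug, weight]
    rw [split vs (deg k v), Nat.mul_mul_mul_comm]
    exact Nat.mul_le_mul (ih _ _) (ih' _ _)

/-- A `β`-redex weighs `4 * (weight t + 1) * weight b`, against at most `weight t * weight b` for
its results. The permutations decrease for the same reason as on lambda-terms: a factor moves inside
a successor. -/
theorem Step.weight_lt {κ : Kind} {e : Pre κ} {E : Set (Pre κ)} (h : Step e E) :
    ∀ e' ∈ E, weight e' < weight e := by
  induction h with
  | beta t b =>
    rintro _ ⟨hd, ws, hws, rfl⟩
    have h₁ := weight_plug_le t 0 ws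
    rw [(hws.map weight).prod_eq, ← weight_toList] at h₁
    have h₂ := weight_pos b
    simp only [weight]
    nlinarith
  | zero => exact fun _ h => h.elim
  | sigma1 t s₁ s₂ =>
    rintro _ rfl
    have h₁ := weight_pos s₁
    have h₂ := two_le_weight s₂
    have := Nat.mul_le_mul_left (weight s₁) h₂
    simp only [weight, weight_shift]
    nlinarith
  | sigma3 v t s =>
    rintro _ rfl
    have h₁ := weight_pos s
    have h₂ := weight_pos v
    have := Nat.mul_le_mul_left (weight s) h₂
    simp only [weight, weight_shift]
    nlinarith
  | lam _ ih => rintro _ ⟨t, ht, rfl⟩; exact Nat.succ_lt_succ (ih t ht)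
  | appL t _ ih =>
    rintro _ ⟨s, hs, rfl⟩; exact Nat.mul_lt_mul_of_pos_right (ih s hs) (weight_pos t)
  | appR s _ ih =>
    rintro _ ⟨t, ht, rfl⟩; exact Nat.mul_lt_mul_of_pos_left (ih t ht) (weight_pos s)
  | bag _ ih => rintro _ ⟨t, ht, rfl⟩; exact Nat.mul_lt_mul_of_pos_left (ih t ht) two_pos
  | consHead b _ ih =>
    rintro _ ⟨s, hs, rfl⟩; exact Nat.mul_lt_mul_of_pos_right (ih s hs) (weight_pos b)
  | consTail v _ ih =>
    rintro _ ⟨t, ht, rfl⟩; exact Nat.mul_lt_mul_of_pos_left (ih t ht) (weight_pos v)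

theorem Step.finite {κ : Kind} {e : Pre κ} {E : Set (Pre κ)} (h : Step e E) : E.Finite := by
  induction h with
  | beta t b =>
    refine ((b.toList.permutations.map (plug 0 t)).finite_toSet).subset ?_
    rintro _ ⟨-, ws, hws, rfl⟩
    exact List.mem_map_of_mem (List.mem_permutations.2 hws)
  | zero => exact Set.finite_empty
  | sigma1 | sigma3 => exact Set.finite_singleton _
  | lam _ ih | appL _ _ ih | appR _ _ ih | bag _ ih | consHead _ _ ih | consTail _ _ ih =>
    exact ih.image _

end Pre
-- Normal forms of sets of resource expressions.
namespace Res

theorem mk_eq_mk {κ : Kind} {e e' : Pre κ} : mk e = mk e' ↔ Pre.Equiv e e' :=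
  ⟨fun h => Quotient.exact h, fun h => Quotient.sound h⟩

/-- The measure `Pre.weight` of a class. -/
def weight {κ : Kind} : Res κ → ℕ := Quotient.lift Pre.weight fun _ _ h => Pre.Equiv.weight_eq h

/-- No representative of the class can be reduced. -/
def Irr {κ : Kind} (a : Res κ) : Prop := ∀ e, mk e = a → e.Irr

theorem setStep_of_mem {κ : Kind} {G : Set (Res κ)} (hG : G.Finite) {e : Pre κ} {E : Set (Pre κ)}
    (he : mk e ∈ G) (h : e.Step E) : SetStep G (mk '' E ∪ G \ {mk e}) :=
  ⟨e, E, G \ {mk e}, h, hG.subset Set.sdiff_subset, fun h => h.2 rfl,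
    by rw [Set.union_sdiff_self, Set.union_eq_right.2 (by simpa using he)], rfl⟩

/-- The reducible elements of largest weight are removed one at a time: contracting one adds only
lighter elements, so their number drops, and once there are none the weight bound drops. -/
theorem exists_normal_of_weight_lt {κ : Kind} (n : ℕ) : ∀ G : Set (Res κ), G.Finite →
    (∀ a ∈ G, ¬ a.Irr → a.weight < n) →
    ∃ F, IsNormalFormOf F G ∧ ∀ a ∈ G, a.Irr → a ∈ F := by
  induction n with
  | zero =>
    intro G _ h
    refine ⟨G, ⟨.refl, ?_⟩, fun a ha _ => ha⟩
    rintro ⟨_, e, E, E₂, he, -, -, rfl, -⟩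
    have : ¬ (mk e).Irr := fun h => h e rfl E he
    exact Nat.not_lt_zero _ (h _ (.inl rfl) this)
  | succ n ih =>
    intro G hG h
    induction hm : {a ∈ G | ¬ a.Irr ∧ a.weight = n}.ncard using Nat.strong_induction_on
      generalizing G with
    | _ m ihm =>
      by_cases hex : ∃ a ∈ G, ¬ a.Irr ∧ a.weight = n
      · obtain ⟨a, ha, hirr, hw⟩ := hex
        obtain ⟨e, rfl, E, hE⟩ : ∃ e, mk e = a ∧ ∃ E, e.Step E := by
          simpa [Irr, Pre.Irr] using hirr
        have hlt : ∀ b ∈ mk '' E, b.weight < n := by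
          rintro _ ⟨e', he', rfl⟩
          exact (hE.weight_lt e' he').trans_eq hw
        have hfin : (mk '' E ∪ G \ {mk e}).Finite :=
          (hE.finite.image _).union (hG.subset Set.sdiff_subset)
        obtain ⟨F, hF, hF'⟩ := ihm _ (by
          rw [← hm]
          refine Set.ncard_lt_ncard ?_ (hG.subset fun _ h => h.1)
          refine Set.ssubset_iff_of_subset ?_ |>.2 ⟨mk e, ⟨ha, hirr, hw⟩, ?_⟩
          · rintro b ⟨hb | hb, hb', hb''⟩
            · exact absurd hb'' (hlt b hb).ne
            · exact ⟨hb.1, hb', hb''⟩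
          · rintro ⟨hb | hb, -⟩
            · exact absurd hw (hlt _ hb).ne
            · exact hb.2 rfl) _ hfin (by
          rintro b (hb | hb) hb'
          exacts [(hlt b hb).trans n.lt_succ_self, h b hb.1 hb']) rfl
        refine ⟨F, ⟨.head (setStep_of_mem hG ha hE) hF.1, hF.2⟩, fun b hb hb' => hF' b ?_ hb'⟩
        -- Only a reducible class is taken out of the set, so irreducible ones survive.
        exact .inr ⟨hb, fun h => hirr (h ▸ hb')⟩
      · refine ih G hG fun a ha hirr => ?_
        exact lt_of_le_of_ne (Nat.le_of_lt_succ (h a ha hirr)) fun hw => hex ⟨a, ha, hirr, hw⟩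

/-- Every finite set has a normal form, that contains its irreducible elements. -/
theorem exists_normal {κ : Kind} {G : Set (Res κ)} (hG : G.Finite) :
    ∃ F, IsNormalFormOf F G ∧ ∀ a ∈ G, a.Irr → a ∈ F := by
  obtain ⟨n, hn⟩ := (hG.image weight).bddAbove
  exact exists_normal_of_weight_lt (n + 1) G hG fun a ha _ =>
    Nat.lt_succ_of_le (hn (Set.mem_image_of_mem _ ha))

theorem exists_steps_of_reds {κ : Kind} {e e' : Pre κ} (h : Pre.Reds e e') :
    ∃ G : Set (Res κ), Relation.ReflTransGen SetStep {mk e} G ∧ G.Finite ∧ mk e' ∈ G := by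
  induction h with
  | refl => exact ⟨_, .refl, Set.finite_singleton _, rfl⟩
  | tail _ h ih =>
    obtain ⟨G, h₁, h₂, h₃⟩ := ih
    obtain ⟨E, hE, he⟩ := h
    exact ⟨_, h₁.tail (setStep_of_mem h₂ h₃ hE),
      (hE.finite.image _).union (h₂.subset Set.sdiff_subset), .inl ⟨_, he, rfl⟩⟩

theorem approx_of_steps {s : Pre .tm} {M : Term} (hs : s.Approx M) {F : Set (Res .tm)}
    (h : Relation.ReflTransGen SetStep {mk s} F) :
    F.Finite ∧ ∀ e, mk e ∈ F → e.Approx M := by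
  induction h with
  | refl => exact ⟨Set.finite_singleton _, fun e he => ((mk_eq_mk.1 he).approx_iff M).2 hs⟩
  | tail _ h ih =>
    obtain ⟨e, E₁, E₂, he, hE₂, -, rfl, rfl⟩ := h
    refine ⟨(he.finite.image _).union hE₂, ?_⟩
    rintro e' (⟨e'', h, h'⟩ | h)
    · exact ((mk_eq_mk.1 h').approx_iff M).1 ((ih.2 e (.inl rfl)).of_step he _ h)
    · exact ih.2 e' (.inr h)

/-- The normal form of the Taylor expansion of a term consists of the irreducible elements of the
expansions of its approximants. -/
theorem mk_mem_NF_taylor_iff {M : Term} {u : Pre .tm} :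
    mk u ∈ NF (taylor M) ↔ ∃ A ∈ approxOf M, u.InTB A ∧ u.Irr := by
  constructor
  · rintro ⟨_, ⟨s, hs, rfl⟩, F, ⟨hF, hn⟩, hu⟩
    obtain ⟨hfin, hap⟩ := approx_of_steps (Pre.mem_taylor_iff.1 hs).approx hF
    have hirr : u.Irr := fun E hE => hn ⟨_, setStep_of_mem hfin hu hE⟩
    obtain ⟨N, hN, huN⟩ := (hap u hu).exists_inT hirr
    obtain ⟨A, hA, h⟩ := exists_approxOf hN (U := {u}) ⟨u, rfl⟩ (by
      rintro _ rfl; exact ⟨huN, hirr⟩)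
    exact ⟨A, hA, h u rfl, hirr⟩
  · rintro ⟨A, ⟨hA, N, hN, hAN⟩, huA, hirr⟩
    obtain ⟨s, hs, hsu⟩ :=
      ((Pre.inTB_toBot u).1 (huA.mono hAN)).exists_reds_of_steps hN hirr.alive
    obtain ⟨G, hG, hfin, hu⟩ := exists_steps_of_reds hsu
    obtain ⟨F, ⟨hF, hn⟩, h⟩ := exists_normal hfin
    refine ⟨_, ⟨s, Pre.mem_taylor_iff.2 hs, rfl⟩, F, ⟨hG.trans hF, hn⟩, h _ hu fun e he => ?_⟩
    -- Irreducibility of the class concerns all representatives; it is transported through `InTB`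
    -- and `Alive`, which are invariant under reordering of bags.
    have heq := mk_eq_mk.1 he
    exact ((heq.inTB_iff A).2 huA).irr hA (heq.alive_iff.2 hirr.alive)

theorem NF_taylor_eq_of_approxOf_eq {M N : Term} (h : approxOf M = approxOf N) :
    NF (taylor M) = NF (taylor N) := by
  ext a
  induction a using Quotient.inductionOn with
  | _ u => exact (mk_mem_NF_taylor_iff.trans (by rw [h])).trans mk_mem_NF_taylor_iff.symm

/-- The expression `full A` is a normal witness of `A`; finding it in the other normal form places
`A` below an approximant of `N`. -/
theorem approxOf_subset_of_NF_taylor_eq {M N : Term} (h : NF (taylor M) = NF (taylor N)) :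
    approxOf M ⊆ approxOf N := by
  intro A hA
  have hM := mk_mem_NF_taylor_iff.2 ⟨A, hA, Pre.inTB_full A, Pre.irr_full hA.1⟩
  rw [h] at hM
  obtain ⟨B, hB, hAB, -⟩ := mk_mem_NF_taylor_iff.1 hM
  exact mem_approxOf_of_below hA.1 (Pre.below_of_full A hAB) hB

end Res

/-! ### Suprema of trees -/

namespace Tree

/-- The labels of the supremum of a directed set are labels of its elements. -/
theorem exists_isLUB_label {S : Set Tree} (hS : DirectedOn (· ≤ ·) S) :
    ∃ T, IsLUB S T ∧ ∀ p a, T.label p = some a → ∃ U ∈ S, U.label p = some a := by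
  have key : ∀ p, ∃ o : Option Label, (∀ a, o = some a → ∃ T ∈ S, T.label p = some a) ∧
      ∀ U ∈ S, ∀ b, U.label p = some b → ∃ a, o = some a ∧ b.Below a := by
    intro p
    by_cases h₁ : ∃ T ∈ S, ∃ a, T.label p = some a ∧ a ≠ .bot
    · obtain ⟨T, hT, a, ha, hne⟩ := h₁
      refine ⟨some a, fun _ h => ⟨T, hT, by rw [ha, h]⟩, fun U hU b hb => ⟨a, rfl, ?_⟩⟩
      obtain ⟨W, -, hTW, hUW⟩ := hS T hT U hU
      obtain ⟨c, hc, hac⟩ := hTW p a ha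
      obtain ⟨c', hc', hbc⟩ := hUW p b hb
      have hcc : c' = c := by simpa [hc'] using hc
      have hca : c = a := by cases hac <;> simp_all
      rwa [hcc, hca] at hbc
    · have h₂ : ∀ T ∈ S, ∀ a, T.label p = some a → a = .bot := by
        intro T hT a ha
        by_contra hne
        exact h₁ ⟨T, hT, a, ha, hne⟩
      by_cases h₃ : ∃ T ∈ S, T.label p = some .bot
      · obtain ⟨T, hT, ha⟩ := h₃
        refine ⟨some .bot, fun _ h => ⟨T, hT, by rw [ha, h]⟩, fun U hU b hb => ⟨.bot, rfl, ?_⟩⟩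
        rw [h₂ U hU b hb]
        exact .refl _
      · refine ⟨none, by simp, fun U hU b hb => absurd ⟨U, hU, ?_⟩ h₃⟩
        rw [hb, h₂ U hU b hb]
  choose l hl₁ hl₂ using key
  refine ⟨⟨l, fun p d => ⟨fun h => ?_, fun h => ?_⟩⟩, ⟨?_, ?_⟩, hl₁⟩
  · obtain ⟨a, ha⟩ := Option.isSome_iff_exists.1 h
    obtain ⟨T, hT, hTa⟩ := hl₁ _ a ha
    rcases (T.wf p d).1 (by simp [hTa]) with h' | ⟨h', hd⟩
    · obtain ⟨c, hc, hac⟩ := hl₂ p T hT _ h'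
      cases hac
      exact .inl hc
    · obtain ⟨c, hc, hac⟩ := hl₂ p T hT _ h'
      cases hac
      exact .inr ⟨hc, hd⟩
  · have : ∃ T ∈ S, (T.label (p ++ [d])).isSome := by
      rcases h with h | ⟨h, hd⟩
      · obtain ⟨T, hT, hTa⟩ := hl₁ _ _ h
        exact ⟨T, hT, (T.wf p d).2 (.inl hTa)⟩
      · obtain ⟨T, hT, hTa⟩ := hl₁ _ _ h
        exact ⟨T, hT, (T.wf p d).2 (.inr ⟨hTa, hd⟩)⟩
    obtain ⟨T, hT, hs⟩ := this
    obtain ⟨a, ha⟩ := Option.isSome_iff_exists.1 hs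
    obtain ⟨c, hc, -⟩ := hl₂ _ T hT a ha
    simp [hc]
  · intro T hT p a ha
    exact hl₂ p T hT a ha
  · intro W hW p a ha
    obtain ⟨T, hT, hTa⟩ := hl₁ p a ha
    exact hW hT p a hTa

theorem isLUB_sup {S : Set Tree} (hS : DirectedOn (· ≤ ·) S) : IsLUB S (sup S) := by
  unfold sup
  rw [dif_pos (exists_isLUB hS)]
  exact (exists_isLUB hS).choose_spec

theorem sup_label {S : Set Tree} (hS : DirectedOn (· ≤ ·) S) {p : List Bool} {a : Label}
    (h : (sup S).label p = some a) : ∃ U ∈ S, U.label p = some a := by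
  obtain ⟨T, hT, hT'⟩ := exists_isLUB_label hS
  rw [(isLUB_sup hS).unique hT] at h
  exact hT' p a h

end Tree

/-! ### Finite trees: compactness and comparison with the order on terms. -/

namespace BotTerm

theorem finite_positions (A : BotTerm) : {p | ∃ a, A.label p = some a}.Finite := by
  induction A with
  | bot | var =>
    refine (Set.finite_singleton []).subset ?_
    rintro (_ | ⟨d, p⟩) ⟨a, h⟩
    · rfl
    · simp [label] at h
  | lam A ih =>
    refine ((ih.image (List.cons false)).insert []).subset ?_
    rintro (_ | ⟨_ | _, p⟩) ⟨a, h⟩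
    · exact .inl rfl
    · exact .inr ⟨p, ⟨a, h⟩, rfl⟩
    · simp [label] at h
  | app A B ih ih' =>
    refine (((ih.image (List.cons false)).union (ih'.image (List.cons true))).insert []).subset ?_
    rintro (_ | ⟨_ | _, p⟩) ⟨a, h⟩
    · exact .inl rfl
    · exact .inr (.inl ⟨p, ⟨a, h⟩, rfl⟩)
    · exact .inr (.inr ⟨p, ⟨a, h⟩, rfl⟩)

/-- The trees of terms with `⊥` are compact. -/
theorem exists_le_of_le_sup {S : Set Tree} (hS : DirectedOn (· ≤ ·) S) {A : BotTerm}
    (h : A.toTree ≤ Tree.sup S) : ∃ U ∈ S, A.toTree ≤ U := by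
  have hne : S.Nonempty := by
    -- The tree of a term has a root, so the supremum above it has one too, and `S` cannot be empty.
    obtain ⟨a, ha⟩ : ∃ a, A.label [] = some a := by cases A <;> exact ⟨_, rfl⟩
    obtain ⟨b, hb, -⟩ := h [] a ha
    obtain ⟨U, hU, -⟩ := Tree.sup_label hS hb
    exact ⟨U, hU⟩
  have key : ∀ P : Set (List Bool), P.Finite → ∃ U ∈ S, ∀ p ∈ P, ∀ a, A.label p = some a →
      ∃ b, U.label p = some b ∧ a.Below b := by
    intro P hP
    induction P, hP using Set.Finite.induction_on with
    | empty => exact hne.imp fun U hU => ⟨hU, fun _ h => h.elim⟩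
    | @insert p P _ _ ih =>
      obtain ⟨U, hU, h₁⟩ := ih
      obtain ⟨V, hV, h₂⟩ : ∃ V ∈ S, ∀ a, A.label p = some a →
          ∃ b, V.label p = some b ∧ a.Below b := by
        rcases hp : A.label p with _ | a
        · exact hne.imp fun U hU => ⟨hU, by simp⟩
        · obtain ⟨b, hb, hab⟩ := h p a hp
          obtain ⟨V, hV, hVb⟩ := Tree.sup_label hS hb
          exact ⟨V, hV, fun a' ha' => ⟨b, hVb, by cases ha'; exact hab⟩⟩
      obtain ⟨W, hW, hUW, hVW⟩ := hS U hU V hV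
      have up {T : Tree} (hT : T ≤ W) {q : List Bool} {a : Label}
          (hq : ∃ b, T.label q = some b ∧ a.Below b) : ∃ b, W.label q = some b ∧ a.Below b := by
        obtain ⟨b, hb, hab⟩ := hq
        obtain ⟨c, hc, hbc⟩ := hT q b hb
        exact ⟨c, hc, by cases hab <;> cases hbc <;> constructor⟩
      refine ⟨W, hW, ?_⟩
      rintro q (rfl | hq) a ha
      exacts [up hVW (h₂ a ha), up hUW (h₁ q hq a ha)]
  obtain ⟨U, hU, h'⟩ := key _ (finite_positions A)
  exact ⟨U, hU, fun p a ha => h' p ⟨a, ha⟩ a ha⟩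

theorem Below.toTree_le {A B : BotTerm} (h : Below A B) : A.toTree ≤ B.toTree := by
  induction h with
  | bot_var n =>
    rintro (_ | ⟨d, p⟩) a h
    · cases h; exact ⟨_, rfl, .bot_var n⟩
    · simp [toTree, label] at h
  | bot_lam M =>
    rintro (_ | ⟨d, p⟩) a h
    · cases h; exact ⟨_, rfl, .bot_lam⟩
    · simp [toTree, label] at h
  | refl => exact le_rfl
  | trans _ _ ih ih' => exact ih.trans ih'
  | lam _ ih =>
    rintro (_ | ⟨_ | _, p⟩) a h
    · exact ⟨a, h, .refl a⟩
    · exact ih p a h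
    · simp [toTree, label] at h
  | app _ _ ih ih' =>
    rintro (_ | ⟨_ | _, p⟩) a h
    · exact ⟨a, h, .refl a⟩
    · exact ih p a h
    · exact ih' p a h

theorem below_of_toTree_le (A : BotTerm) : ∀ {B : BotTerm}, A.toTree ≤ B.toTree → Below A B := by
  induction A with
  | bot =>
    intro B h
    obtain ⟨b, hb, hab⟩ := h [] _ rfl
    cases B with
    | bot => exact .refl _
    | var n => exact .bot_var n
    | lam B => exact .bot_lam B
    | app => cases hb; cases hab
  | var n =>
    intro B h
    obtain ⟨b, hb, hab⟩ := h [] _ rfl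
    cases hab
    cases B <;> cases hb
    exact .refl _
  | lam A ih =>
    intro B h
    obtain ⟨b, hb, hab⟩ := h [] _ rfl
    cases hab
    cases B <;> cases hb
    exact .lam (ih fun p a => h (false :: p) a)
  | app A A' ih ih' =>
    intro B h
    obtain ⟨b, hb, hab⟩ := h [] _ rfl
    cases hab
    cases B <;> cases hb
    exact .app (ih fun p a => h (false :: p) a) (ih' fun p a => h (true :: p) a)

end BotTerm

/-! ### Böhm trees determine the sets of approximants. -/

theorem directedOn_toTree (M : Term) :
    DirectedOn (· ≤ ·) (BotTerm.toTree '' approxOf M) := by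
  rintro _ ⟨A, hA, rfl⟩ _ ⟨B, hB, rfl⟩
  obtain ⟨C, hC, h, h'⟩ := directed_approxOf hA hB
  exact ⟨_, ⟨C, hC, rfl⟩, h.toTree_le, h'.toTree_le⟩

/-- By compactness, an approximant below the Böhm tree of `N` is below a single approximant of `N`,
hence is one itself by downward closure. -/
theorem approxOf_subset_of_bohmTree_eq {M N : Term} (h : bohmTree M = bohmTree N) :
    approxOf M ⊆ approxOf N := by
  intro A hA
  have hle : A.toTree ≤ bohmTree M := (Tree.isLUB_sup (directedOn_toTree M)).1 ⟨A, hA, rfl⟩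
  rw [h] at hle
  obtain ⟨_, ⟨B, hB, rfl⟩, hAB⟩ := BotTerm.exists_le_of_le_sup (directedOn_toTree N) hle
  exact mem_approxOf_of_below hA.1 (A.below_of_toTree_le hAB) hB

end CbV

theorem mainTheorem2 (M N : CbV.Term) :
    CbV.bohmTree M = CbV.bohmTree N ↔
      CbV.Res.NF (CbV.taylor M) = CbV.Res.NF (CbV.taylor N) := by
  refine ⟨fun h => CbV.Res.NF_taylor_eq_of_approxOf_eq ?_, fun h => ?_⟩
  · exact (CbV.approxOf_subset_of_bohmTree_eq h).antisymm
      (CbV.approxOf_subset_of_bohmTree_eq h.symm)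
  · rw [CbV.bohmTree, CbV.bohmTree, (CbV.Res.approxOf_subset_of_NF_taylor_eq h).antisymm
      (CbV.Res.approxOf_subset_of_NF_taylor_eq h.symm)]
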